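/- An algebra is a nonempty set with finitary operations, and a variety is an equationally definable class $\mathcal V$ of algebras in a fixed language. Let $\vec 0=(0_1,\dots,0_l)$ and $\vec 1=(1_1,\dots,1_l)$ be tuples of closed terms such that $\vec 0=\vec 1\rightarrow x=y$ holds in every member of $\mathcal V$ ("$\mathcal V$ is a variety with $\vec 0$ & $\vec 1$"). Congruences $\theta,\theta^*$ of $A$ are complementary factor congruences if they are the kernels of the two canonical projections of some direct product representation $A\cong A_1\times A_2$; a factor congruence is a member of such a pair. Write $[\vec a,\vec b]=(\langle a_1,b_1\rangle,\dots,\langle a_l,b_l\rangle)$. A tuple $\vec e\in A^l$ is central if some isomorphism $A\to A_1\times A_2$ maps it to $[\vec 0,\vec 1]$; and $\vec e,\vec f\in A^l$ are complementary central elements if some isomorphism $A\to A_1\times A_2$ maps $\vec e$ to $[\vec 0,\vec 1]$ and $\vec f$ to $[\vec 1,\vec 0]$. **Theorem.** The following are equivalent: 1. (Weak Determining Property) for every $A\in\mathcal V$, the map sending $(\theta,\theta^*)$ to the unique $(\vec e,\vec f)\in A^l\times A^l$ with $\vec 0\,\theta\,\vec e\,\theta^*\,\vec 1$ and $\vec 1\,\theta\,\vec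 f\,\theta^*\,\vec 0$ is a bijection from the set of pairs of complementary factor congruences of $A$ onto the set of pairs of complementary central elements of $A$; 2. (Determining Property) for every $A\in\mathcal V$, the map sending $(\theta,\theta^*)$ to the unique $\vec e\in A^l$ with $\vec 0\,\theta\,\vec e\,\theta^*\,\vec 1$ is a bijection from the set of pairs of complementary factor congruences of $A$ onto the set of central elements of $A$; 3. (Definable Factor Congruences) there is a first-order formula $\Phi(x,y,\vec z)$ in the language of $\mathcal V$ such that for all $A,B\in\mathcal V$, $a,c\in A$ and $b,d\in B$: $A\times B\models\Phi(\langle a,b\rangle,\langle c,d\rangle,[\vec 0,\vec 1])$ if and only if $a=c$; 4. there is a first-order formula $\Phi(x,y,\vec z,\vec w)$ in the language of $\mathcal V$ such that for all $A,B\in\mathcal V$, $a,c\in A$ and $b,d\in B$: $A\times B\models\Phi(\langle a,b\rangle,\langle c,d\rangle,[\vec 0,\vec 1],[\vec 1,\vec 0])$ if and only if $a=c$; 5. (Boolean Factor Congruences) for every $A\in\mathcal V$, the set of factor congruences of $A$ is a distributive sublattice of the congruence lattice of $A$. Moreover, when these conditions hold, a formula $\Phi$ as in (3) can be chosen that is preserved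 by direct products and by direct factors; for every $A\in\mathcal V$ the factor congruences of $A$ form a Boolean algebra under the operations of the congruence lattice; and for every formula $\Phi$ as in (3) and every $A\in\mathcal V$, the map $\vec e\mapsto\Phi^A(\cdot,\cdot,\vec e)=\{(x,y)\in A^2: A\models\Phi(x,y,\vec e)\}$ is a bijection from the set of central elements of $A$ onto the set of factor congruences of $A$. -/

import Mathlib

open scoped FirstOrder

universe u v w

namespace FactorCongruences

variable {L : FirstOrder.Language.{u, v}}

/-- Direct product of two structures, with coordinatewise operations. -/
instance prodStructure {A B : Type*} [L.Structure A] [L.Structure B] : L.Structure (A × B) where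
  funMap f x := (FirstOrder.Language.Structure.funMap f fun i => (x i).1,
    FirstOrder.Language.Structure.funMap f fun i => (x i).2)
  RelMap r x := (FirstOrder.Language.Structure.RelMap r fun i => (x i).1) ∧
    FirstOrder.Language.Structure.RelMap r fun i => (x i).2

/-- Direct product of a family of structures, with coordinatewise operations. -/
instance piStructure {I : Type*} {A : I → Type*} [∀ i, L.Structure (A i)] :
    L.Structure (∀ i, A i) where
  funMap f x := fun i => FirstOrder.Language.Structure.funMap f fun k => x k i
  RelMap r x := ∀ i, FirstOrder.Language.Structure.RelMap r fun k => x k i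

/-- The structure `A` satisfies all identities of `E` (pairs of terms over countably many
variables), i.e. it belongs to the variety axiomatized by `E`. Algebras are nonempty: wherever
members of the variety are quantified over, `Nonempty A` is required separately. -/
def InVariety (E : Set (L.Term ℕ × L.Term ℕ)) (A : Type w) [L.Structure A] : Prop :=
  ∀ p ∈ E, ∀ x : ℕ → A, p.1.realize x = p.2.realize x

/-- The interpretation in `A` of a tuple of closed terms. -/
def val {l : ℕ} (t : Fin l → L.Term Empty) (A : Type w) [L.Structure A] : Fin l → A :=
  fun i => (t i).realize (Empty.elim : Empty → A)

/-- In every algebra of the variety, `0⃗ = 1⃗` implies `x = y` for all `x`, `y`. -/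
def IsZeroOne (E : Set (L.Term ℕ × L.Term ℕ)) {l : ℕ} (zero one : Fin l → L.Term Empty) : Prop :=
  ∀ (A : Type w) [L.Structure A] [Nonempty A], InVariety E A →
    val zero A = val one A → ∀ x y : A, x = y

/-- A congruence of an algebra. -/
structure Cong (L : FirstOrder.Language.{u, v}) (A : Type w) [L.Structure A] extends Setoid A where
  compat : ∀ {n : ℕ} (f : L.Functions n) (x y : Fin n → A), (∀ i, r (x i) (y i)) →
    r (FirstOrder.Language.Structure.funMap f x) (FirstOrder.Language.Structure.funMap f y)

namespace Cong

variable {A : Type w} [L.Structure A]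

theorem toSetoid_injective :
    Function.Injective (Cong.toSetoid : Cong L A → Setoid A) := by
  rintro ⟨s, hs⟩ ⟨t, ht⟩ h
  cases h
  rfl

/-- Congruences are ordered by inclusion. -/
instance : PartialOrder (Cong L A) := PartialOrder.lift Cong.toSetoid toSetoid_injective

instance : InfSet (Cong L A) where
  sInf S :=
    { r := fun a b => ∀ θ ∈ S, θ.r a b
      iseqv := ⟨fun a θ _ => θ.iseqv.refl a, fun h θ hθ => θ.iseqv.symm (h θ hθ),
        fun h k θ hθ => θ.iseqv.trans (h θ hθ) (k θ hθ)⟩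
      compat := fun f x y h θ hθ => θ.compat f x y fun i => h i θ hθ }

theorem isGLB_sInf (S : Set (Cong L A)) : IsGLB S (sInf S) :=
  ⟨fun θ hθ _ _ h => h θ hθ, fun _ hφ _ _ h θ hθ => hφ hθ h⟩

/-- The complete lattice of congruences; its joins are the generated congruences. -/
instance : CompleteLattice (Cong L A) :=
  { completeLatticeOfInf (Cong L A) isGLB_sInf with
    inf := fun θ φ =>
      { r := fun a b => θ.r a b ∧ φ.r a b
        iseqv := ⟨fun a => ⟨θ.iseqv.refl a, φ.iseqv.refl a⟩,
          fun h => ⟨θ.iseqv.symm h.1, φ.iseqv.symm h.2⟩,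
          fun h k => ⟨θ.iseqv.trans h.1 k.1, φ.iseqv.trans h.2 k.2⟩⟩
        compat := fun f x y h =>
          ⟨θ.compat f x y fun i => (h i).1, φ.compat f x y fun i => (h i).2⟩ }
    inf_le_left := fun _ _ _ _ h => h.1
    inf_le_right := fun _ _ _ _ h => h.2
    le_inf := fun _ _ _ h k _ _ hr => ⟨h hr, k hr⟩
    top :=
      { r := fun _ _ => True
        iseqv := ⟨fun _ => trivial, fun _ => trivial, fun _ _ => trivial⟩
        compat := fun _ _ _ _ => trivial }
    le_top := fun _ _ _ _ => trivial
    bot :=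
      { r := fun a b => a = b
        iseqv := ⟨fun _ => rfl, fun h => h.symm, fun h k => h.trans k⟩
        compat := fun _ x y h => by rw [show x = y from funext h] }
    bot_le := fun θ a b (h : a = b) => h ▸ θ.iseqv.refl a }

/-- `θ` and `φ` are complementary factor congruences: they are the kernels of the two canonical
projections of some direct product representation `A ≅ B × C`. -/
def Complementary (θ φ : Cong L A) : Prop :=
  ∃ (B C : Type w) (_ : L.Structure B) (_ : L.Structure C) (h : A ≃[L] B × C),
    (∀ x y, θ.r x y ↔ (h x).1 = (h y).1) ∧ (∀ x y, φ.r x y ↔ (h x).2 = (h y).2)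

/-- `θ` is a factor congruence: the kernel of a projection onto a direct factor. -/
def IsFactor (θ : Cong L A) : Prop := ∃ φ : Cong L A, Complementary θ φ

/-- Two tuples are related coordinatewise. -/
def RelTuple (θ : Cong L A) {l : ℕ} (a b : Fin l → A) : Prop := ∀ i, θ.r (a i) (b i)

end Cong

/-- `e` is a central element: some isomorphism `A ≅ B × C` maps it to `[0⃗, 1⃗]`. -/
def IsCentral {l : ℕ} (zero one : Fin l → L.Term Empty) {A : Type w} [L.Structure A]
    (e : Fin l → A) : Prop :=
  ∃ (B C : Type w) (_ : L.Structure B) (_ : L.Structure C) (h : A ≃[L] B × C),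
    ∀ i, h (e i) = (val zero B i, val one C i)

/-- `e` and `f` are complementary central elements: some isomorphism `A ≅ B × C` maps `e` to
`[0⃗, 1⃗]` and `f` to `[1⃗, 0⃗]`. -/
def IsComplementaryCentral {l : ℕ} (zero one : Fin l → L.Term Empty) {A : Type w} [L.Structure A]
    (e f : Fin l → A) : Prop :=
  ∃ (B C : Type w) (_ : L.Structure B) (_ : L.Structure C) (h : A ≃[L] B × C),
    (∀ i, h (e i) = (val zero B i, val one C i)) ∧
    (∀ i, h (f i) = (val one B i, val zero C i))

/-- Weak Determining Property: sending a pair `(θ, θ*)` of complementary factor congruences to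
the unique pair `(e, f)` with `0⃗ θ e θ* 1⃗` and `1⃗ θ f θ* 0⃗` is a well-defined bijection onto the
pairs of complementary central elements. -/
def WeakDeterminingProperty (E : Set (L.Term ℕ × L.Term ℕ)) {l : ℕ}
    (zero one : Fin l → L.Term Empty) : Prop :=
  ∀ (A : Type w) [L.Structure A] [Nonempty A], InVariety E A →
    ∃ F : {p : Cong L A × Cong L A // Cong.Complementary p.1 p.2} →
        {q : (Fin l → A) × (Fin l → A) // IsComplementaryCentral zero one q.1 q.2},
      (∀ (p : {p : Cong L A × Cong L A // Cong.Complementary p.1 p.2}) (e f : Fin l → A),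
        (p.1.1.RelTuple (val zero A) e ∧ p.1.2.RelTuple e (val one A) ∧
          p.1.1.RelTuple (val one A) f ∧ p.1.2.RelTuple f (val zero A)) ↔ (e, f) = (F p).1) ∧
      Function.Bijective F

/-- Determining Property: sending a pair `(θ, θ*)` of complementary factor congruences to the
unique `e` with `0⃗ θ e θ* 1⃗` is a well-defined bijection onto the central elements. -/
def DeterminingProperty (E : Set (L.Term ℕ × L.Term ℕ)) {l : ℕ}
    (zero one : Fin l → L.Term Empty) : Prop :=
  ∀ (A : Type w) [L.Structure A] [Nonempty A], InVariety E A →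
    ∃ F : {p : Cong L A × Cong L A // Cong.Complementary p.1 p.2} →
        {e : Fin l → A // IsCentral zero one e},
      (∀ (p : {p : Cong L A × Cong L A // Cong.Complementary p.1 p.2}) (e : Fin l → A),
        (p.1.1.RelTuple (val zero A) e ∧ p.1.2.RelTuple e (val one A)) ↔ e = (F p).1) ∧
      Function.Bijective F

/-- The formula `Φ(x, y, z⃗)` defines, with parameter `[0⃗, 1⃗]`, the kernel of the first projection
of every product of two members of the variety. -/
def DefinesKernel (E : Set (L.Term ℕ × L.Term ℕ)) {l : ℕ} (zero one : Fin l → L.Term Empty)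
    (Φ : L.Formula (Fin 2 ⊕ Fin l)) : Prop :=
  ∀ (A B : Type w) [L.Structure A] [L.Structure B] [Nonempty A] [Nonempty B],
    InVariety E A → InVariety E B → ∀ (a c : A) (b d : B),
      Φ.Realize (Sum.elim ![(a, b), (c, d)] fun i => (val zero A i, val one B i)) ↔ a = c

/-- The same with a formula `Φ(x, y, z⃗, w⃗)` and the parameters `[0⃗, 1⃗]`, `[1⃗, 0⃗]`. -/
def DefinesKernelTwo (E : Set (L.Term ℕ × L.Term ℕ)) {l : ℕ} (zero one : Fin l → L.Term Empty)
    (Φ : L.Formula (Fin 2 ⊕ (Fin l ⊕ Fin l))) : Prop :=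
  ∀ (A B : Type w) [L.Structure A] [L.Structure B] [Nonempty A] [Nonempty B],
    InVariety E A → InVariety E B → ∀ (a c : A) (b d : B),
      Φ.Realize (Sum.elim ![(a, b), (c, d)] (Sum.elim
        (fun i => (val zero A i, val one B i)) fun i => (val one A i, val zero B i))) ↔ a = c

/-- Definable Factor Congruences. -/
def DefinableFactorCongruences (E : Set (L.Term ℕ × L.Term ℕ)) {l : ℕ}
    (zero one : Fin l → L.Term Empty) : Prop :=
  ∃ Φ : L.Formula (Fin 2 ⊕ Fin l), DefinesKernel.{u, v, w} E zero one Φ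

/-- Definable Factor Congruences with two parameter tuples. -/
def DefinableFactorCongruencesTwo (E : Set (L.Term ℕ × L.Term ℕ)) {l : ℕ}
    (zero one : Fin l → L.Term Empty) : Prop :=
  ∃ Φ : L.Formula (Fin 2 ⊕ (Fin l ⊕ Fin l)), DefinesKernelTwo.{u, v, w} E zero one Φ

/-- The subset `S` is a distributive sublattice. -/
def IsDistribSublattice {X : Type*} [Lattice X] (S : Set X) : Prop :=
  (∀ a ∈ S, ∀ b ∈ S, a ⊔ b ∈ S ∧ a ⊓ b ∈ S) ∧
    ∀ a ∈ S, ∀ b ∈ S, ∀ c ∈ S, a ⊓ (b ⊔ c) = (a ⊓ b) ⊔ (a ⊓ c)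

/-- The subset `S` is a Boolean algebra under the operations and bounds of the ambient lattice. -/
def IsBooleanSublattice {X : Type*} [Lattice X] [BoundedOrder X] (S : Set X) : Prop :=
  IsDistribSublattice S ∧ ⊥ ∈ S ∧ ⊤ ∈ S ∧ ∀ a ∈ S, ∃ b ∈ S, IsCompl a b

/-- Boolean Factor Congruences: in every member of the variety the factor congruences form a
distributive sublattice of the congruence lattice. -/
def BooleanFactorCongruences (E : Set (L.Term ℕ × L.Term ℕ)) : Prop :=
  ∀ (A : Type w) [L.Structure A] [Nonempty A], InVariety E A →
    IsDistribSublattice {θ : Cong L A | θ.IsFactor}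

/-- `Φ` is preserved by direct products (of arbitrary families of algebras). -/
def PreservedByProducts {α : Type} (Φ : L.Formula α) : Prop :=
  ∀ (I : Type w) (A : I → Type w) [∀ i, L.Structure (A i)] [∀ i, Nonempty (A i)]
    (x : α → ∀ i, A i), (∀ i, Φ.Realize fun k => x k i) → Φ.Realize x

/-- `Φ` is preserved by taking direct factors. -/
def PreservedByFactors {α : Type} (Φ : L.Formula α) : Prop :=
  ∀ (A B : Type w) [L.Structure A] [L.Structure B] [Nonempty A] [Nonempty B]
    (x : α → A × B), Φ.Realize x →
      (Φ.Realize fun k => (x k).1) ∧ (Φ.Realize fun k => (x k).2)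

/-- On the algebra `A`, `e ↦ Φ^A(·, ·, e)` is a well-defined bijection from the central elements
onto the factor congruences. -/
def CentralBijection {l : ℕ} (zero one : Fin l → L.Term Empty) (Φ : L.Formula (Fin 2 ⊕ Fin l))
    (A : Type w) [L.Structure A] : Prop :=
  ∃ F : {e : Fin l → A // IsCentral zero one e} → {θ : Cong L A // θ.IsFactor},
    (∀ (e : {e : Fin l → A // IsCentral zero one e}) (x y : A),
      (F e).1.r x y ↔ Φ.Realize (Sum.elim ![x, y] e.1)) ∧ Function.Bijective F

end FactorCongruences

-- A pair of complementary factor congruences `θ`, `θ'` amounts to a decomposition operation `D`,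
-- where `D x y` is the unique element with `x θ (D x y) θ' y`. Each of the first four properties
-- implies that the pair of tuples `(e, f)` attached to `(θ, θ')` determines `θ`.
--
-- Apply this to `A × A`. Let `φ` be a factor congruence and `D` any decomposition operation of `A`.
-- The map `(x, y) ↦ (D x y, D y x)` is an involutive automorphism of `A × A` fixing the diagonal.
-- It therefore fixes the central elements `(e, e)`, `(f, f)` attached to `φ × φ`, hence preserves
-- `φ × φ`; this says that `φ` is compatible with `D` (`factorsDecompose_of_determined`).
-- Compatibility with all decompositions makes factor congruences permute and yields closure under
-- meet and join, distributivity and complements.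
--
-- Conversely, assume distributivity and let `0 φ e θ' 1`. Then `φ ⊔ θ'` identifies `0` with `1`, so
-- it is `⊤`, and `θ = θ ⊓ (φ ⊔ θ') ≤ φ` (`le_of_relTuple`). Both determining properties follow.
--
-- For definability, the inequality `θ ≤ φ` is read as the inconsistency of a set of first-order
-- conditions on two decomposition operations, whose finite part is isolated by compactness. The
-- formula is a game on the values of finitely many terms: an existential player evaluates the
-- operations of the language and of `θ`, a universal player those of `φ`. If `z` is central with
-- kernel containing `(x, y)`, the existential player wins by computing honestly. If the formula
-- holds in a product where `z` has first coordinate `0`, a universal player using the product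
-- decomposition forces `x` and `y` to agree in the first coordinate (`exists_formula`). Nothing
-- else is asked of the two factors, so the formula can be replaced, through a Feferman–Vaught
-- argument, by one preserved by products and factors (`exists_preserved_formula`).

universe w'

namespace FactorCongruences

variable {L : FirstOrder.Language.{u, v}}

open FirstOrder.Language (BoundedFormula Formula Term Theory)
open FirstOrder.Language.Structure (funMap RelMap)

/-! ### Homomorphisms, products and membership in the variety. -/

section Homs

variable {A : Type*} {B : Type*} {C : Type*} [L.Structure A] [L.Structure B] [L.Structure C]

/-- A map commuting with all operations, as a homomorphism of algebras. -/
def homOfFunMap [L.IsAlgebraic] (g : A → B)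
    (hg : ∀ {n : ℕ} (f : L.Functions n) (x : Fin n → A), g (funMap f x) = funMap f (g ∘ x)) :
    A →[L] B where
  toFun := g
  map_fun' := hg
  map_rel' r := isEmptyElim r

@[simp]
theorem homOfFunMap_apply [L.IsAlgebraic] (g : A → B)
    (hg : ∀ {n : ℕ} (f : L.Functions n) (x : Fin n → A), g (funMap f x) = funMap f (g ∘ x))
    (a : A) : homOfFunMap g hg a = g a := rfl

/-- A bijection commuting with all operations, as an isomorphism of algebras. -/
def equivOfFunMap [L.IsAlgebraic] (g : A ≃ B)
    (hg : ∀ {n : ℕ} (f : L.Functions n) (x : Fin n → A), g (funMap f x) = funMap f (g ∘ x)) :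
    A ≃[L] B where
  toEquiv := g
  map_fun' := hg
  map_rel' r := isEmptyElim r

/-- The first projection of a product of two structures. -/
def fstHom (A B : Type*) [L.Structure A] [L.Structure B] : A × B →[L] A where
  toFun := Prod.fst
  map_fun' _ _ := rfl
  map_rel' _ _ h := h.1

/-- The second projection of a product of two structures. -/
def sndHom (A B : Type*) [L.Structure A] [L.Structure B] : A × B →[L] B where
  toFun := Prod.snd
  map_fun' _ _ := rfl
  map_rel' _ _ h := h.2

/-- A projection of a product of a family of structures. -/
def evalHom {I : Type*} (A : I → Type*) [∀ i, L.Structure (A i)] (i : I) : (∀ i, A i) →[L] A i where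
  toFun x := x i
  map_fun' _ _ := rfl
  map_rel' _ _ h := h i

@[simp] theorem fstHom_apply (p : A × B) : fstHom (L := L) A B p = p.1 := rfl

@[simp] theorem sndHom_apply (p : A × B) : sndHom (L := L) A B p = p.2 := rfl

@[simp] theorem evalHom_apply {I : Type*} (A : I → Type*) [∀ i, L.Structure (A i)] (i : I)
    (x : ∀ i, A i) : evalHom (L := L) A i x = x i := rfl

theorem hom_val {A : Type w} {B : Type w'} [L.Structure A] [L.Structure B] {l : ℕ}
    (t : Fin l → L.Term Empty) (g : A →[L] B) (i : Fin l) : g (val t A i) = val t B i := by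
  unfold val
  rw [← FirstOrder.Language.HomClass.realize_term]
  congr 1
  exact Subsingleton.elim _ _

theorem val_prod {A : Type w} {B : Type w'} [L.Structure A] [L.Structure B] {l : ℕ}
    (t : Fin l → L.Term Empty) (i : Fin l) : val t (A × B) i = (val t A i, val t B i) :=
  Prod.ext (hom_val t (fstHom A B) i) (hom_val t (sndHom A B) i)

theorem val_pi {I : Type*} {A : I → Type*} [∀ i, L.Structure (A i)] {l : ℕ}
    (t : Fin l → L.Term Empty) (k : Fin l) : val t (∀ i, A i) k = fun i => val t (A i) k :=
  funext fun i => hom_val t (evalHom A i) k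

theorem InVariety.of_surjective {A : Type w} {B : Type w'} [L.Structure A] [L.Structure B]
    {E : Set (L.Term ℕ × L.Term ℕ)} (hA : InVariety E A)
    (g : A →[L] B) (hg : Function.Surjective g) : InVariety E B := by
  intro p hp x
  choose s hs using hg
  have hx : x = g ∘ (s ∘ x) := funext fun n => (hs (x n)).symm
  rw [hx, FirstOrder.Language.HomClass.realize_term, FirstOrder.Language.HomClass.realize_term,
    hA p hp]

theorem InVariety.of_homs {ι : Type*} {A : Type w} {B : ι → Type w'} [L.Structure A]
    [∀ i, L.Structure (B i)] {E : Set (L.Term ℕ × L.Term ℕ)} (hB : ∀ i, InVariety E (B i))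
    (g : ∀ i, A →[L] B i) (hg : ∀ a b, (∀ i, g i a = g i b) → a = b) : InVariety E A := by
  intro p hp x
  refine hg _ _ fun i => ?_
  rw [← FirstOrder.Language.HomClass.realize_term, ← FirstOrder.Language.HomClass.realize_term,
    hB i p hp]

theorem InVariety.prod {A B : Type w} [L.Structure A] [L.Structure B]
    {E : Set (L.Term ℕ × L.Term ℕ)} (hA : InVariety E A) (hB : InVariety E B) :
    InVariety E (A × B) := by
  intro p hp x
  refine Prod.ext ?_ ?_
  · have := hA p hp (fstHom (L := L) A B ∘ x)
    rwa [FirstOrder.Language.HomClass.realize_term, FirstOrder.Language.HomClass.realize_term]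
      at this
  · have := hB p hp (sndHom (L := L) A B ∘ x)
    rwa [FirstOrder.Language.HomClass.realize_term, FirstOrder.Language.HomClass.realize_term]
      at this

theorem InVariety.pi {I : Type*} {A : I → Type w} [∀ i, L.Structure (A i)]
    {E : Set (L.Term ℕ × L.Term ℕ)} (hA : ∀ i, InVariety E (A i)) : InVariety E (∀ i, A i) :=
  InVariety.of_homs hA (evalHom A) fun _ _ h => funext h

end Homs

/-! ### Decomposition operations and complementary factor congruences. -/

/-- A decomposition operation: for a direct product representation `A ≅ B × C`, the operation
sending `(b, c)` and `(b', c')` to `(b, c')`. -/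
structure IsDecomp (L : FirstOrder.Language.{u, v}) {A : Type w} [L.Structure A]
    (D : A → A → A) : Prop where
  idem : ∀ a, D a a = a
  left : ∀ a b c, D (D a b) c = D a c
  right : ∀ a b c, D a (D b c) = D a c
  map : ∀ {n : ℕ} (f : L.Functions n) (x y : Fin n → A),
    D (funMap f x) (funMap f y) = funMap f fun i => D (x i) (y i)

theorem IsDecomp.swap {A : Type w} [L.Structure A] {D : A → A → A} (hD : IsDecomp L D) :
    IsDecomp L fun a b => D b a where
  idem := hD.idem
  left a b c := hD.right c b a
  right a b c := hD.left c b a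
  map f x y := hD.map f y x

theorem isDecomp_prod (A : Type w) (B : Type w') [L.Structure A] [L.Structure B] :
    IsDecomp L fun p q : A × B => (p.1, q.2) where
  idem _ := rfl
  left _ _ _ := rfl
  right _ _ _ := rfl
  map _ _ _ := rfl

theorem IsDecomp.pi {I : Type w'} {A : I → Type w} [∀ i, L.Structure (A i)]
    {D : ∀ i, A i → A i → A i} (hD : ∀ i, IsDecomp L (D i)) :
    IsDecomp L fun (x y : ∀ i, A i) i => D i (x i) (y i) where
  idem _ := funext fun i => (hD i).idem _
  left _ _ _ := funext fun i => (hD i).left _ _ _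
  right _ _ _ := funext fun i => (hD i).right _ _ _
  map f x y := funext fun i => (hD i).map f (fun k => x k i) fun k => y k i

namespace Cong

variable {A : Type w} [L.Structure A] {θ θ' φ φ' ψ : Cong L A}

/-- The inverse image of a congruence under a homomorphism. -/
def comap {B : Type w'} [L.Structure B] (g : B →[L] A) (θ : Cong L A) : Cong L B where
  r a b := θ.r (g a) (g b)
  iseqv := ⟨fun _ => θ.iseqv.refl _, fun h => θ.iseqv.symm h, fun h k => θ.iseqv.trans h k⟩
  compat f x y h := by
    rw [g.map_fun, g.map_fun]
    exact θ.compat f _ _ h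

theorem ext_r (h : ∀ x y, θ.r x y ↔ φ.r x y) : θ = φ :=
  le_antisymm (fun x y hx => (h x y).1 hx) fun x y hx => (h x y).2 hx

theorem sup_left_r {x y : A} (h : θ.r x y) : (θ ⊔ φ).r x y :=
  (le_sup_left : θ ≤ θ ⊔ φ) h

theorem sup_right_r {x y : A} (h : φ.r x y) : (θ ⊔ φ).r x y :=
  (le_sup_right : φ ≤ θ ⊔ φ) h

/-- The quotient algebra by a congruence. -/
@[reducible]
noncomputable def quotientStructure (θ : Cong L A) : L.Structure (Quotient θ.toSetoid) where
  funMap f x := Quotient.mk _ (funMap f fun i => (x i).out)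
  RelMap _ _ := False

/-- The canonical projection onto the quotient algebra. -/
noncomputable def quotientHom [L.IsAlgebraic] (θ : Cong L A) :
    letI := θ.quotientStructure
    A →[L] Quotient θ.toSetoid :=
  letI := θ.quotientStructure
  homOfFunMap (Quotient.mk θ.toSetoid) fun f x =>
    Quotient.sound (θ.compat f _ _ fun i => θ.iseqv.symm (Quotient.mk_out (s := θ.toSetoid) (x i)))

/-- The two conditions are injectivity and surjectivity of the canonical map from `A` to the product
of its quotients by `θ` and `φ`. -/
theorem complementary_iff [L.IsAlgebraic] : Complementary θ φ ↔
    (∀ x y, θ.r x y → φ.r x y → x = y) ∧ ∀ x y, ∃ z, θ.r x z ∧ φ.r z y := by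
  constructor
  · rintro ⟨B, C, _, _, h, h1, h2⟩
    refine ⟨fun x y hx hy => h.injective (Prod.ext ((h1 x y).1 hx) ((h2 x y).1 hy)),
      fun x y => ⟨h.symm ((h x).1, (h y).2), ?_, ?_⟩⟩
    · rw [h1, h.apply_symm_apply]
    · rw [h2, h.apply_symm_apply]
  · rintro ⟨h1, h2⟩
    let := θ.quotientStructure
    let := φ.quotientStructure
    have hb : Function.Bijective fun a : A => (θ.quotientHom a, φ.quotientHom a) := by
      constructor
      · intro a b hab
        exact h1 a b (Quotient.exact (Prod.ext_iff.1 hab).1) (Quotient.exact (Prod.ext_iff.1 hab).2)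
      · rintro ⟨a, b⟩
        induction a using Quotient.inductionOn with | _ a
        induction b using Quotient.inductionOn with | _ b
        obtain ⟨z, hz, hz'⟩ := h2 a b
        exact ⟨z, Prod.ext (Quotient.sound (θ.iseqv.symm hz)) (Quotient.sound hz')⟩
    refine ⟨Quotient θ.toSetoid, Quotient φ.toSetoid, inferInstance, inferInstance,
      equivOfFunMap (Equiv.ofBijective _ hb) ?_, ?_, ?_⟩
    · intro n f x
      exact Prod.ext (θ.quotientHom.map_fun f x) (φ.quotientHom.map_fun f x)
    · exact fun x y => Quotient.eq (r := θ.toSetoid).symm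
    · exact fun x y => Quotient.eq (r := φ.toSetoid).symm

theorem Complementary.symm [L.IsAlgebraic] (h : Complementary θ φ) : Complementary φ θ := by
  rw [complementary_iff] at h ⊢
  refine ⟨fun x y hx hy => h.1 x y hy hx, fun x y => ?_⟩
  obtain ⟨z, hz, hz'⟩ := h.2 y x
  exact ⟨z, φ.iseqv.symm hz', θ.iseqv.symm hz⟩

theorem Complementary.isFactor (h : Complementary θ φ) : θ.IsFactor := ⟨φ, h⟩

theorem complementary_bot_top [L.IsAlgebraic] : Complementary (⊥ : Cong L A) ⊤ :=
  complementary_iff.2 ⟨fun _ _ h _ => h, fun x _ => ⟨x, rfl, trivial⟩⟩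

theorem Complementary.isCompl [L.IsAlgebraic] (h : Complementary θ φ) : IsCompl θ φ := by
  rw [complementary_iff] at h
  refine IsCompl.of_eq (le_bot_iff.1 fun x y hxy => h.1 x y hxy.1 hxy.2)
    (top_le_iff.1 fun x y _ => ?_)
  obtain ⟨z, hz, hz'⟩ := h.2 x y
  exact (θ ⊔ φ).iseqv.trans (sup_left_r hz) (sup_right_r hz')

/-- All identities follow from uniqueness: both sides are related by `θ` to the same left argument
and by `φ` to the same right argument. -/
theorem Complementary.exists_isDecomp [L.IsAlgebraic] (h : Complementary θ φ) :
    ∃ D : A → A → A, IsDecomp L D ∧ (∀ x y, θ.r x (D x y)) ∧ ∀ x y, φ.r (D x y) y := by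
  obtain ⟨h1, h2⟩ := complementary_iff.1 h
  choose D hD hD' using h2
  have key : ∀ x y z, θ.r x z → φ.r z y → D x y = z := fun x y z hx hy =>
    h1 _ _ (θ.iseqv.trans (θ.iseqv.symm (hD x y)) hx) (φ.iseqv.trans (hD' x y) (φ.iseqv.symm hy))
  refine ⟨D, ⟨fun a => key _ _ _ (θ.iseqv.refl a) (φ.iseqv.refl a), fun a b c => ?_, fun a b c => ?_,
    fun f x y => ?_⟩, hD, hD'⟩
  · exact key _ _ _ (θ.iseqv.trans (θ.iseqv.symm (hD a b)) (hD a c)) (hD' a c)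
  · exact key _ _ _ (hD a c) (φ.iseqv.trans (hD' a c) (φ.iseqv.symm (hD' b c)))
  · exact key _ _ _ (θ.compat f _ _ fun i => hD (x i) (y i)) (φ.compat f _ _ fun i => hD' (x i) (y i))

theorem Complementary.eq_of_r [L.IsAlgebraic] (h : Complementary θ φ) {x y : A} (h1 : θ.r x y)
    (h2 : φ.r x y) : x = y :=
  (complementary_iff.1 h).1 x y h1 h2

/-- The kernel of the projection onto the first factor of a decomposition operation. -/
def ofDecomp {D : A → A → A} (hD : IsDecomp L D) : Cong L A where
  r x y := D x y = y
  iseqv := by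
    refine ⟨hD.idem, fun {x y} h => ?_, fun {x y z} h k => ?_⟩
    · rw [← h, hD.left, hD.idem]
    · calc D x z = D (D x y) z := (hD.left x y z).symm
        _ = z := by rw [h, k]
  compat f x y h := by
    rw [hD.map]
    exact congrArg _ (funext h)

theorem ofDecomp_r {D : A → A → A} (hD : IsDecomp L D) (x y : A) :
    (ofDecomp hD).r x y ↔ D x y = y := Iff.rfl

theorem complementary_ofDecomp [L.IsAlgebraic] {D : A → A → A} (hD : IsDecomp L D) :
    Complementary (ofDecomp hD) (ofDecomp hD.swap) := by
  refine complementary_iff.2 ⟨fun x y h k => ?_, fun x y => ⟨D x y, ?_, ?_⟩⟩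
  · rw [ofDecomp_r] at h k
    have h' := (ofDecomp hD.swap).iseqv.symm (show (ofDecomp hD.swap).r x y from k)
    rw [ofDecomp_r] at h'
    exact h'.symm.trans h
  · rw [ofDecomp_r, hD.right]
  · rw [ofDecomp_r, hD.right, hD.idem]

/-- This is `θ × θ` and `φ × φ` transported along a bijection `B → A × A`. For `B = A × A` it is
used with the two projections and with the components of an involution. -/
theorem Complementary.comap_inf [L.IsAlgebraic] {B : Type w} [L.Structure B]
    (h : Complementary θ φ) (g₁ g₂ : B →[L] A)
    (hg : Function.Bijective fun b => (g₁ b, g₂ b)) :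
    Complementary (θ.comap g₁ ⊓ θ.comap g₂) (φ.comap g₁ ⊓ φ.comap g₂) := by
  rw [complementary_iff] at h ⊢
  refine ⟨fun x y hx hy => hg.1 (Prod.ext (h.1 _ _ hx.1 hy.1) (h.1 _ _ hx.2 hy.2)), fun x y => ?_⟩
  obtain ⟨a, ha, ha'⟩ := h.2 (g₁ x) (g₁ y)
  obtain ⟨b, hb, hb'⟩ := h.2 (g₂ x) (g₂ y)
  obtain ⟨z, hz⟩ := hg.2 (a, b)
  obtain ⟨rfl, rfl⟩ := Prod.ext_iff.1 hz
  exact ⟨z, ⟨ha, hb⟩, ha', hb'⟩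

end Cong

open Cong

/-! ### Determination by central elements forces compatibility with decompositions. -/

/-- Pairs of complementary factor congruences with the same associated pair of central elements
have the same first component. -/
def DeterminedByCentralPairs (E : Set (L.Term ℕ × L.Term ℕ)) {l : ℕ}
    (zero one : Fin l → L.Term Empty) : Prop :=
  ∀ (A : Type w) [L.Structure A] [Nonempty A], InVariety E A →
    ∀ θ θ' φ φ' : Cong L A, Complementary θ θ' → Complementary φ φ' → ∀ e f : Fin l → A,
      θ.RelTuple (val zero A) e → θ'.RelTuple e (val one A) →
      θ.RelTuple (val one A) f → θ'.RelTuple f (val zero A) →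
      φ.RelTuple (val zero A) e → φ'.RelTuple e (val one A) →
      φ.RelTuple (val one A) f → φ'.RelTuple f (val zero A) → θ = φ

/-- Every factor congruence is compatible with every direct decomposition. -/
def FactorsDecompose (E : Set (L.Term ℕ × L.Term ℕ)) : Prop :=
  ∀ (A : Type w) [L.Structure A] [Nonempty A], InVariety E A →
    ∀ D : A → A → A, IsDecomp L D → ∀ φ : Cong L A, φ.IsFactor →
      ∀ x y x' y', φ.r x x' → φ.r y y' → φ.r (D x y) (D x' y')

theorem Cong.Complementary.exists_tuple [L.IsAlgebraic] {A : Type w} [L.Structure A]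
    {θ φ : Cong L A} (h : Complementary θ φ) {l : ℕ} (a b : Fin l → A) :
    ∃ e : Fin l → A, θ.RelTuple a e ∧ φ.RelTuple e b := by
  choose e he he' using fun i => (complementary_iff.1 h).2 (a i) (b i)
  exact ⟨e, he, he'⟩

theorem Cong.Complementary.tuple_eq [L.IsAlgebraic] {A : Type w} [L.Structure A]
    {θ φ : Cong L A} (h : Complementary θ φ) {l : ℕ} {a b e e' : Fin l → A}
    (h1 : θ.RelTuple a e) (h2 : φ.RelTuple e b) (h3 : θ.RelTuple a e') (h4 : φ.RelTuple e' b) :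
    e = e' :=
  funext fun i => h.eq_of_r (θ.iseqv.trans (θ.iseqv.symm (h1 i)) (h3 i))
    (φ.iseqv.trans (h2 i) (φ.iseqv.symm (h4 i)))

theorem factorsDecompose_of_determined [L.IsAlgebraic] {E : Set (L.Term ℕ × L.Term ℕ)} {l : ℕ}
    {zero one : Fin l → L.Term Empty}
    (H : DeterminedByCentralPairs.{u, v, w} E zero one) : FactorsDecompose.{u, v, w} E := by
  have main : ∀ (A : Type w) [L.Structure A] [Nonempty A], InVariety E A →
    ∀ D : A → A → A, IsDecomp L D → ∀ φ : Cong L A, φ.IsFactor →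
      ∀ x x' z, φ.r x x' → φ.r (D x z) (D x' z) := by
    rintro A _ _ hA D hD φ ⟨φ', hφ⟩ x x' z hx
    obtain ⟨e, he, he'⟩ := hφ.exists_tuple (val zero A) (val one A)
    obtain ⟨f, hf, hf'⟩ := hφ.exists_tuple (val one A) (val zero A)
    -- The components of the involution; applying it twice to `(a, b)` gives `(D a a, D b b) = (a,
    -- b)`.
    let s₁ : A × A →[L] A := homOfFunMap (fun p => D p.1 p.2) fun f x =>
      hD.map f (fun i => (x i).1) fun i => (x i).2
    let s₂ : A × A →[L] A := homOfFunMap (fun p => D p.2 p.1) fun f x =>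
      hD.map f (fun i => (x i).2) fun i => (x i).1
    have hs : Function.Bijective fun p : A × A => (s₁ p, s₂ p) := by
      refine Function.Involutive.bijective fun p => ?_
      simp [s₁, s₂, hD.left, hD.right, hD.idem]
    have hp : Function.Bijective fun p : A × A => (fstHom (L := L) A A p, sndHom (L := L) A A p) :=
      Function.bijective_id
    have aux : ∀ (ψ : Cong L A) (g : A × A →[L] A), (∀ a, g (a, a) = a) →
        ∀ (a : A × A) (b : A), ψ.r (g a) b → (ψ.comap g).r a (b, b) := by
      intro ψ g hg a b h
      show ψ.r (g a) (g (b, b))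
      rwa [hg]
    have h₁ : ∀ a, s₁ (a, a) = a := hD.idem
    have h₂ : ∀ a, s₂ (a, a) = a := hD.idem
    have h₃ : ∀ a : A, fstHom (L := L) A A (a, a) = a := fun _ => rfl
    have h₄ : ∀ a : A, sndHom (L := L) A A (a, a) = a := fun _ => rfl
    have aux2 : ∀ (ψ : Cong L A) (g g' : A × A →[L] A), (∀ a, g (a, a) = a) →
        (∀ a, g' (a, a) = a) → ∀ (t : Fin l → L.Term Empty) (c : Fin l → A),
        ψ.RelTuple (val t A) c →
          (ψ.comap g ⊓ ψ.comap g').RelTuple (val t (A × A)) fun i => (c i, c i) := by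
      intro ψ g g' hg hg' t c h i
      exact ⟨aux ψ g hg _ _ (by rw [hom_val]; exact h i),
        aux ψ g' hg' _ _ (by rw [hom_val]; exact h i)⟩
    have sym : ∀ {B : Type w} [L.Structure B] (ψ : Cong L B) {a b : Fin l → B},
        ψ.RelTuple a b → ψ.RelTuple b a := fun ψ a b h i => ψ.iseqv.symm (h i)
    -- Both copies of `φ × φ` send the constants to the same diagonal tuples, since the projections
    -- and `s₁`, `s₂` all map `(a, a)` to `a`.
    have key := H (A × A) (hA.prod hA) _ _ _ _ (hφ.comap_inf _ _ hp) (hφ.comap_inf _ _ hs)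
      (fun i => (e i, e i)) (fun i => (f i, f i))
      (aux2 _ _ _ h₃ h₄ _ _ he) (sym _ (aux2 _ _ _ h₃ h₄ _ _ (sym _ he')))
      (aux2 _ _ _ h₃ h₄ _ _ hf) (sym _ (aux2 _ _ _ h₃ h₄ _ _ (sym _ hf')))
      (aux2 _ _ _ h₁ h₂ _ _ he) (sym _ (aux2 _ _ _ h₁ h₂ _ _ (sym _ he')))
      (aux2 _ _ _ h₁ h₂ _ _ hf) (sym _ (aux2 _ _ _ h₁ h₂ _ _ (sym _ hf')))
    have hxz : (φ.comap (fstHom (L := L) A A) ⊓ φ.comap (sndHom A A)).r (x, z) (x', z) :=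
      ⟨hx, φ.iseqv.refl z⟩
    rw [key] at hxz
    exact hxz.1
  intro A _ _ hA D hD φ hφ x y x' y' hx hy
  exact φ.iseqv.trans (main A hA D hD φ hφ x x' y hx)
    (main A hA _ hD.swap φ hφ y y' x' hy)

/-! ### The lattice of factor congruences. -/

section Boolean

variable [L.IsAlgebraic] {E : Set (L.Term ℕ × L.Term ℕ)} {A : Type w} [L.Structure A]
  [Nonempty A]

/-- Factor congruences permute, and the middle element is `D x y` for the decomposition attached to
`φ`. -/
theorem FactorsDecompose.sup_r (H : FactorsDecompose.{u, v, w} E) (hA : InVariety E A)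
    {θ φ : Cong L A} (hθ : θ.IsFactor) (hφ : φ.IsFactor) {x y : A} (h : (θ ⊔ φ).r x y) :
    ∃ z, θ.r x z ∧ φ.r z y := by
  obtain ⟨φ', hφ⟩ := hφ
  obtain ⟨D, hD, hD1, hD2⟩ := hφ.symm.exists_isDecomp
  have hpres := H A hA D hD θ hθ
  -- Compatibility of `θ` with `D` makes `x θ (D x y)` a congruence in `x` and `y`. It contains `φ`
  -- because `D x y = x` when `x φ y`, so it contains the join.
  let K : Cong L A :=
    { r := fun x y => θ.r (D x y) x
      iseqv := by
        refine ⟨fun x => ?_, fun {x y} h => ?_, fun {x y z} h k => ?_⟩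
        · rw [hD.idem]
        · have := hpres y _ y _ (θ.iseqv.refl y) h
          rw [hD.right, hD.idem] at this
          exact θ.iseqv.symm this
        · have := hpres x _ x _ (θ.iseqv.refl x) k
          rw [hD.right] at this
          exact θ.iseqv.trans this h
      compat := fun f x y h => by
        rw [hD.map]
        exact θ.compat f _ _ h }
  have hK : θ ⊔ φ ≤ K := by
    refine sup_le (fun x y hxy => ?_) fun x y hxy => ?_
    · have := hpres x y x x (θ.iseqv.refl x) (θ.iseqv.symm hxy)
      rw [hD.idem] at this
      exact this
    · have : D x y = x := hφ.symm.eq_of_r (φ'.iseqv.symm (hD1 x y))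
        (φ.iseqv.trans (hD2 x y) (φ.iseqv.symm hxy))
      show θ.r (D x y) x
      rw [this]
  exact ⟨D x y, θ.iseqv.symm (hK h), hD2 x y⟩

theorem FactorsDecompose.complementary_inf_sup (H : FactorsDecompose.{u, v, w} E)
    (hA : InVariety E A) {θ θ' φ φ' : Cong L A} (hθ : Complementary θ θ')
    (hφ : Complementary φ φ') : Complementary (θ ⊓ φ) (θ' ⊔ φ') := by
  obtain ⟨D, hD, hD1, hD2⟩ := hθ.exists_isDecomp
  obtain ⟨D', hD', hD1', hD2'⟩ := hφ.exists_isDecomp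
  -- The element joining `x` to `y`: `D x (D' x y)` is `θ`-related to `x`, is `φ`-related to `D x x
  -- = x`, and reaches `y` through `D' x y` by `θ'` and then `φ'`.
  refine complementary_iff.2 ⟨fun x y hxy hxy' => ?_, fun x y => ⟨D x (D' x y), ⟨hD1 _ _, ?_⟩, ?_⟩⟩
  · obtain ⟨z, hz, hz'⟩ := H.sup_r hA hθ.symm.isFactor hφ.symm.isFactor hxy'
    have h1 : φ'.r (D x z) y := by
      have := H A hA D hD φ' hφ.symm.isFactor x z x y (φ'.iseqv.refl x) hz'
      rwa [show D x y = y from hθ.eq_of_r (θ.iseqv.trans (θ.iseqv.symm (hD1 x y)) hxy.1)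
        (hD2 x y)] at this
    have h2 : D x z = x := hθ.eq_of_r (θ.iseqv.symm (hD1 x z))
        (θ'.iseqv.trans (hD2 x z) (θ'.iseqv.symm hz))
    rw [h2] at h1
    exact hφ.eq_of_r hxy.2 h1
  · have := H A hA D hD φ hφ.isFactor x x x (D' x y) (φ.iseqv.refl x) (hD1' x y)
    rwa [hD.idem] at this
  · exact (θ' ⊔ φ').iseqv.trans (sup_left_r (hD2 _ _)) (sup_right_r (hD2' _ _))

theorem FactorsDecompose.isBooleanSublattice (H : FactorsDecompose.{u, v, w} E)
    (hA : InVariety E A) : IsBooleanSublattice {θ : Cong L A | θ.IsFactor} := by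
  refine ⟨⟨?_, ?_⟩, complementary_bot_top.isFactor, complementary_bot_top.symm.isFactor, ?_⟩
  · rintro θ ⟨θ', hθ⟩ φ ⟨φ', hφ⟩
    exact ⟨(H.complementary_inf_sup hA hθ.symm hφ.symm).symm.isFactor,
      (H.complementary_inf_sup hA hθ hφ).isFactor⟩
  · rintro θ ⟨θ', hθ⟩ φ hφ ψ hψ
    -- Let `x φ z ψ y` with `x θ y`. Applying `D x` to the chain gives `x = D x x`, `D x z`, `D x y
    -- = y`, whose members are moreover all `θ`-related.
    refine le_antisymm (fun x y hxy => ?_) le_inf_sup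
    obtain ⟨D, hD, hD1, hD2⟩ := hθ.exists_isDecomp
    obtain ⟨z, hz, hz'⟩ := H.sup_r hA hφ hψ hxy.2
    have h1 := H A hA D hD φ hφ x x x z (φ.iseqv.refl x) hz
    have h2 := H A hA D hD ψ hψ x z x y (ψ.iseqv.refl x) hz'
    rw [hD.idem] at h1
    rw [show D x y = y from hθ.eq_of_r (θ.iseqv.trans (θ.iseqv.symm (hD1 x y)) hxy.1)
      (hD2 x y)] at h2
    exact (θ ⊓ φ ⊔ θ ⊓ ψ).iseqv.trans (sup_left_r ⟨hD1 x z, h1⟩)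
      (sup_right_r ⟨θ.iseqv.trans (θ.iseqv.symm (hD1 x z)) hxy.1, h2⟩)
  · rintro θ ⟨θ', hθ⟩
    exact ⟨θ', hθ.symm.isFactor, hθ.isCompl⟩

theorem IsZeroOne.eq_top {l : ℕ} {zero one : Fin l → L.Term Empty}
    (h01 : IsZeroOne.{u, v, w} E zero one) (hA : InVariety E A) {θ : Cong L A}
    (h : θ.RelTuple (val zero A) (val one A)) : θ = ⊤ := by
  let := θ.quotientStructure
  have : Nonempty (Quotient θ.toSetoid) := ⟨Quotient.mk _ (Classical.arbitrary A)⟩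
  have := h01 (Quotient θ.toSetoid) (hA.of_surjective θ.quotientHom Quotient.mk_surjective) ?_
  · exact top_le_iff.1 fun x y _ => Quotient.exact (this (Quotient.mk _ x) (Quotient.mk _ y))
  · funext i
    rw [← hom_val zero θ.quotientHom, ← hom_val one θ.quotientHom]
    exact Quotient.sound (h i)

/-- The tuple `e` links `0` to `1` through `φ` and `θ'`, so their join is `⊤`; distributing `θ` over
this join leaves `θ ⊓ φ`, because `θ ⊓ θ' = ⊥`. -/
theorem BooleanFactorCongruences.le_of_relTuple {l : ℕ} {zero one : Fin l → L.Term Empty}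
    (H : BooleanFactorCongruences.{u, v, w} E) (h01 : IsZeroOne.{u, v, w} E zero one)
    (hA : InVariety E A) {θ θ' φ : Cong L A} (hθ : Complementary θ θ') (hφ : φ.IsFactor)
    {e : Fin l → A} (h1 : φ.RelTuple (val zero A) e) (h2 : θ'.RelTuple e (val one A)) :
    θ ≤ φ := by
  have htop : φ ⊔ θ' = ⊤ := h01.eq_top hA fun i =>
    (φ ⊔ θ').iseqv.trans (sup_left_r (h1 i)) (sup_right_r (h2 i))
  have := (H A hA).2 θ hθ.isFactor φ hφ θ' hθ.symm.isFactor
  rw [htop, inf_top_eq, hθ.isCompl.inf_eq_bot, sup_bot_eq] at this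
  exact this.le.trans inf_le_right

end Boolean

/-! ### A Feferman–Vaught argument for products. -/

section Autonomous

variable {α : Type} {n : ℕ}

/-- Two assignments satisfy the same formulas of `S`. -/
def SameType (S : Set (L.BoundedFormula α n)) {M : Type w} {N : Type w'} [L.Structure M]
    [L.Structure N] (v : α → M) (xs : Fin n → M) (v' : α → N) (xs' : Fin n → N) : Prop :=
  ∀ σ ∈ S, σ.Realize v xs ↔ σ.Realize v' xs'

theorem SameType.symm {S : Set (L.BoundedFormula α n)} {M : Type w} {N : Type w'} [L.Structure M]
    [L.Structure N] {v : α → M} {xs : Fin n → M} {v' : α → N} {xs' : Fin n → N}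
    (h : SameType S v xs v' xs') : SameType S v' xs' v xs :=
  fun σ hσ => (h σ hσ).symm

theorem SameType.trans {S : Set (L.BoundedFormula α n)} {M N P : Type w} [L.Structure M]
    [L.Structure N] [L.Structure P] {v : α → M} {xs : Fin n → M} {v' : α → N} {xs' : Fin n → N}
    {v'' : α → P} {xs'' : Fin n → P} (h : SameType S v xs v' xs')
    (k : SameType S v' xs' v'' xs'') : SameType S v xs v'' xs'' :=
  fun σ hσ => (h σ hσ).trans (k σ hσ)

theorem SameType.mono {S T : Set (L.BoundedFormula α n)} {M : Type w} {N : Type w'}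
    [L.Structure M] [L.Structure N] {v : α → M} {xs : Fin n → M} {v' : α → N} {xs' : Fin n → N}
    (h : SameType S v xs v' xs') (hT : T ⊆ S) : SameType T v xs v' xs' :=
  fun σ hσ => h σ (hT hσ)

/-- A finite set of formulas whose truth values in a direct product are determined by their truth
values in the factors. -/
structure IsAutonomous (S : Set (L.BoundedFormula α n)) : Prop where
  finite : S.Finite
  pi : ∀ {I : Type w} {A B : I → Type w} [∀ i, L.Structure (A i)] [∀ i, L.Structure (B i)]
    (v : α → ∀ i, A i) (xs : Fin n → ∀ i, A i) (v' : α → ∀ i, B i) (xs' : Fin n → ∀ i, B i),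
    (∀ i, SameType S (fun k => v k i) (fun k => xs k i) (fun k => v' k i) fun k => xs' k i) →
      SameType S v xs v' xs'
  prod : ∀ {A B A' B' : Type w} [L.Structure A] [L.Structure B] [L.Structure A'] [L.Structure B']
    (v : α → A × B) (xs : Fin n → A × B) (v' : α → A' × B') (xs' : Fin n → A' × B'),
    SameType S (fun k => (v k).1) (fun k => (xs k).1) (fun k => (v' k).1) (fun k => (xs' k).1) →
    SameType S (fun k => (v k).2) (fun k => (xs k).2) (fun k => (v' k).2) (fun k => (xs' k).2) →
      SameType S v xs v' xs'

open Classical in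
/-- The formula asserting that exactly the formulas of `Y` among those of `S` hold. -/
noncomputable def typeFormula (S : Set (L.BoundedFormula α n)) [Finite S] (Y : Set S) :
    L.BoundedFormula α n :=
  BoundedFormula.iInf fun σ : S => if σ ∈ Y then σ.1 else ∼σ.1

theorem realize_typeFormula (S : Set (L.BoundedFormula α n)) [Finite S] (Y : Set S) {M : Type w}
    [L.Structure M] (v : α → M) (xs : Fin n → M) :
    (typeFormula S Y).Realize v xs ↔ ∀ σ : S, σ.1.Realize v xs ↔ σ ∈ Y := by
  rw [typeFormula, BoundedFormula.realize_iInf]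
  refine forall_congr' fun σ => ?_
  split_ifs with h <;> simp [h]

/-- The formulas asserting the existence of an element of a given `S`-type. -/
def exTypes (S : Set (L.BoundedFormula α (n + 1))) [Finite S] : Set (L.BoundedFormula α n) :=
  Set.range fun Y : Set S => (typeFormula S Y).ex

theorem SameType.forth {S : Set (L.BoundedFormula α (n + 1))} [Finite S] {M N : Type w}
    [L.Structure M] [L.Structure N] {v : α → M} {xs : Fin n → M} {v' : α → N} {xs' : Fin n → N}
    (h : SameType (exTypes S) v xs v' xs') (x : M) :
    ∃ y, SameType S v (Fin.snoc xs x) v' (Fin.snoc xs' y) := by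
  have := (h _ ⟨{σ | σ.1.Realize v (Fin.snoc xs x)}, rfl⟩).1 (by
    rw [BoundedFormula.realize_ex]
    exact ⟨x, (realize_typeFormula _ _ _ _).2 fun _ => Iff.rfl⟩)
  rw [BoundedFormula.realize_ex] at this
  obtain ⟨y, hy⟩ := this
  exact ⟨y, fun σ hσ => ((realize_typeFormula _ _ _ _).1 hy ⟨σ, hσ⟩).symm⟩

/-- Agreement on one more variable, in both directions, transfers every quantified statement over
`S`. -/
theorem sameType_of_back_and_forth {S : Set (L.BoundedFormula α (n + 1))} [Finite S]
    {φ : L.BoundedFormula α (n + 1)} (hφ : φ ∈ S) {M N : Type w}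
    [L.Structure M] [L.Structure N] {v : α → M} {xs : Fin n → M} {v' : α → N} {xs' : Fin n → N}
    (h : ∀ x, ∃ y, SameType S v (Fin.snoc xs x) v' (Fin.snoc xs' y))
    (k : ∀ y, ∃ x, SameType S v' (Fin.snoc xs' y) v (Fin.snoc xs x)) :
    SameType (insert φ.all (exTypes S)) v xs v' xs' := by
  rintro σ (rfl | ⟨Y, rfl⟩)
  · simp only [BoundedFormula.realize_all]
    constructor
    · intro H y
      obtain ⟨x, hx⟩ := k y
      exact (hx φ hφ).2 (H x)
    · intro H x
      obtain ⟨y, hy⟩ := h x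
      exact (hy φ hφ).2 (H y)
  · simp only [BoundedFormula.realize_ex, realize_typeFormula]
    constructor
    · rintro ⟨x, hx⟩
      obtain ⟨y, hy⟩ := h x
      exact ⟨y, fun σ => (hy σ σ.2).symm.trans (hx σ)⟩
    · rintro ⟨y, hy⟩
      obtain ⟨x, hx⟩ := k y
      exact ⟨x, fun σ => (hx σ σ.2).symm.trans (hy σ)⟩

theorem comp_snoc_eta {M : Type*} {N : Type*} (g : M → N) (xs : Fin n → M) (x : M) :
    (fun k => g ((Fin.snoc xs x : Fin (n + 1) → M) k)) =
      (Fin.snoc (fun k => g (xs k)) (g x) : Fin (n + 1) → N) :=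
  Fin.comp_snoc g xs x

/-- Equality of `exTypes` in the factors lets a witness in the product be matched coordinate by
coordinate. The matched coordinates assemble into an element of the other product, which has the
right `S`-type because `S` is autonomous. -/
theorem IsAutonomous.insert_all {S : Set (L.BoundedFormula α (n + 1))}
    (hS : IsAutonomous.{u, v, w} S) [Finite S] {φ : L.BoundedFormula α (n + 1)} (hφ : φ ∈ S) :
    IsAutonomous.{u, v, w} (insert φ.all (exTypes S)) where
  finite := (Set.finite_range _).insert _
  pi := by
    intro I A B _ _
    have aux : ∀ {A B : I → Type w} [∀ i, L.Structure (A i)] [∀ i, L.Structure (B i)]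
        (v : α → ∀ i, A i) (xs : Fin n → ∀ i, A i) (v' : α → ∀ i, B i) (xs' : Fin n → ∀ i, B i),
        (∀ i, SameType (exTypes S) (fun k => v k i) (fun k => xs k i) (fun k => v' k i)
          fun k => xs' k i) →
        ∀ x, ∃ y, SameType S v (Fin.snoc xs x) v' (Fin.snoc xs' y) := by
      intro A B _ _ v xs v' xs' h x
      choose y hy using fun i => (h i).forth (x i)
      refine ⟨y, hS.pi _ _ _ _ fun i => ?_⟩
      rw [comp_snoc_eta (fun z : ∀ i, A i => z i), comp_snoc_eta (fun z : ∀ i, B i => z i)]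
      exact hy i
    intro v xs v' xs' h
    exact sameType_of_back_and_forth hφ
      (aux _ _ _ _ fun i => (h i).mono (Set.subset_insert _ _))
      (aux _ _ _ _ fun i => ((h i).mono (Set.subset_insert _ _)).symm)
  prod := by
    have aux : ∀ {A B A' B' : Type w} [L.Structure A] [L.Structure B] [L.Structure A']
        [L.Structure B'] (v : α → A × B) (xs : Fin n → A × B) (v' : α → A' × B')
        (xs' : Fin n → A' × B'),
        SameType (exTypes S) (fun k => (v k).1) (fun k => (xs k).1) (fun k => (v' k).1)
          (fun k => (xs' k).1) →
        SameType (exTypes S) (fun k => (v k).2) (fun k => (xs k).2) (fun k => (v' k).2)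
          (fun k => (xs' k).2) →
        ∀ x, ∃ y, SameType S v (Fin.snoc xs x) v' (Fin.snoc xs' y) := by
      intro A B A' B' _ _ _ _ v xs v' xs' h k x
      obtain ⟨y, hy⟩ := h.forth x.1
      obtain ⟨z, hz⟩ := k.forth x.2
      refine ⟨(y, z), hS.prod _ _ _ _ ?_ ?_⟩
      · rw [comp_snoc_eta Prod.fst, comp_snoc_eta Prod.fst]
        exact hy
      · rw [comp_snoc_eta Prod.snd, comp_snoc_eta Prod.snd]
        exact hz
    intro A B A' B' _ _ _ _ v xs v' xs' h k
    exact sameType_of_back_and_forth hφ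
      (aux _ _ _ _ (h.mono (Set.subset_insert _ _)) (k.mono (Set.subset_insert _ _)))
      (aux _ _ _ _ (h.mono (Set.subset_insert _ _)).symm (k.mono (Set.subset_insert _ _)).symm)

theorem IsAutonomous.insert_imp {S T : Set (L.BoundedFormula α n)}
    (hS : IsAutonomous.{u, v, w} S) (hT : IsAutonomous.{u, v, w} T)
    {φ ψ : L.BoundedFormula α n} (hφ : φ ∈ S) (hψ : ψ ∈ T) :
    IsAutonomous.{u, v, w} (insert (φ.imp ψ) (S ∪ T)) := by
  have aux : ∀ {M N : Type w} [L.Structure M] [L.Structure N] {v : α → M} {xs : Fin n → M}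
      {v' : α → N} {xs' : Fin n → N}, SameType S v xs v' xs' → SameType T v xs v' xs' →
      SameType (insert (φ.imp ψ) (S ∪ T)) v xs v' xs' := by
    rintro M N _ _ v xs v' xs' h k σ (rfl | hσ | hσ)
    · exact imp_congr (h φ hφ) (k ψ hψ)
    · exact h σ hσ
    · exact k σ hσ
  have hl : S ⊆ insert (φ.imp ψ) (S ∪ T) := Set.subset_union_left.trans (Set.subset_insert _ _)
  have hr : T ⊆ insert (φ.imp ψ) (S ∪ T) := Set.subset_union_right.trans (Set.subset_insert _ _)
  exact
    { finite := (hS.finite.union hT.finite).insert _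
      pi := fun v xs v' xs' h => aux (hS.pi _ _ _ _ fun i => (h i).mono hl)
        (hT.pi _ _ _ _ fun i => (h i).mono hr)
      prod := fun v xs v' xs' h k => aux (hS.prod _ _ _ _ (h.mono hl) (k.mono hl))
        (hT.prod _ _ _ _ (h.mono hr) (k.mono hr)) }

theorem hom_realize_sumElim {M : Type w} {N : Type w'} [L.Structure M] [L.Structure N]
    (g : M →[L] N) (t : L.Term (α ⊕ Fin n)) (v : α → M) (xs : Fin n → M) :
    t.realize (Sum.elim (fun k => g (v k)) fun k => g (xs k)) = g (t.realize (Sum.elim v xs)) := by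
  rw [← FirstOrder.Language.HomClass.realize_term, Sum.comp_elim]
  rfl

theorem isAutonomous_equal (t₁ t₂ : L.Term (α ⊕ Fin n)) :
    IsAutonomous.{u, v, w} {BoundedFormula.equal t₁ t₂} where
  finite := Set.finite_singleton _
  pi := by
    rintro I A B _ _ v xs v' xs' h σ rfl
    have aux : ∀ {A : I → Type w} [∀ i, L.Structure (A i)] (v : α → ∀ i, A i)
        (xs : Fin n → ∀ i, A i), (BoundedFormula.equal t₁ t₂).Realize v xs ↔
          ∀ i, (BoundedFormula.equal t₁ t₂).Realize (fun k => v k i) fun k => xs k i := by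
      intro A _ v xs
      refine funext_iff.trans (forall_congr' fun i => ?_)
      have h₁ := hom_realize_sumElim (evalHom A i) t₁ v xs
      have h₂ := hom_realize_sumElim (evalHom A i) t₂ v xs
      simp only [evalHom_apply] at h₁ h₂
      rw [← h₁, ← h₂]
      rfl
    rw [aux, aux]
    exact forall_congr' fun i => h i _ rfl
  prod := by
    rintro A B A' B' _ _ _ _ v xs v' xs' h k σ rfl
    have aux : ∀ {A B : Type w} [L.Structure A] [L.Structure B] (v : α → A × B)
        (xs : Fin n → A × B), (BoundedFormula.equal t₁ t₂).Realize v xs ↔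
          (BoundedFormula.equal t₁ t₂).Realize (fun k => (v k).1) (fun k => (xs k).1) ∧
          (BoundedFormula.equal t₁ t₂).Realize (fun k => (v k).2) (fun k => (xs k).2) := by
      intro A B _ _ v xs
      refine Prod.ext_iff.trans (and_congr ?_ ?_)
      · have h₁ := hom_realize_sumElim (fstHom A B) t₁ v xs
        have h₂ := hom_realize_sumElim (fstHom A B) t₂ v xs
        simp only [fstHom_apply] at h₁ h₂
        rw [← h₁, ← h₂]
        rfl
      · have h₁ := hom_realize_sumElim (sndHom A B) t₁ v xs
        have h₂ := hom_realize_sumElim (sndHom A B) t₂ v xs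
        simp only [sndHom_apply] at h₁ h₂
        rw [← h₁, ← h₂]
        rfl
    rw [aux, aux]
    exact and_congr (h _ rfl) (k _ rfl)

theorem isAutonomous_falsum :
    IsAutonomous.{u, v, w} {(BoundedFormula.falsum : L.BoundedFormula α n)} where
  finite := Set.finite_singleton _
  pi := by
    rintro I A B _ _ v xs v' xs' h σ rfl
    exact Iff.rfl
  prod := by
    rintro A B A' B' _ _ _ _ v xs v' xs' h k σ rfl
    exact Iff.rfl

/-- A form of the Feferman–Vaught theorem: every formula belongs to a finite set of formulas whose
truth values in direct products are determined by their truth values in the factors. -/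
theorem exists_isAutonomous [L.IsAlgebraic] (φ : L.BoundedFormula α n) :
    ∃ S, IsAutonomous.{u, v, w} S ∧ φ ∈ S := by
  induction φ with
  | falsum => exact ⟨_, isAutonomous_falsum, rfl⟩
  | equal t₁ t₂ => exact ⟨_, isAutonomous_equal t₁ t₂, rfl⟩
  | rel R ts => exact isEmptyElim R
  | imp φ ψ hφ hψ =>
    obtain ⟨S, hS, hφS⟩ := hφ
    obtain ⟨T, hT, hψT⟩ := hψ
    exact ⟨_, hS.insert_imp hT hφS hψT, Set.mem_insert _ _⟩
  | all φ hφ =>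
    obtain ⟨S, hS, hφS⟩ := hφ
    have := hS.finite.to_subtype
    exact ⟨_, hS.insert_all hφS, Set.mem_insert _ _⟩

/-- For every class `T` of pointed algebras closed under direct products and every formula `Φ`,
there is a formula preserved by direct products and direct factors which holds on `T`, such that
each of its models is a direct factor of an algebra agreeing on `Φ` with a member of `T`. -/
theorem exists_preserved_formula [L.IsAlgebraic]
    (T : ∀ (M : Type w) [L.Structure M], (α → M) → Prop)
    (hT : ∀ {I : Type w} (A : I → Type w) [∀ i, L.Structure (A i)] (p : α → ∀ i, A i),
      (∀ i, T (A i) fun k => p k i) → T (∀ i, A i) p) (Φ : L.Formula α) :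
    ∃ Ψ : L.Formula α, PreservedByProducts.{u, v, w} Ψ ∧ PreservedByFactors.{u, v, w} Ψ ∧
      (∀ (M : Type w) [L.Structure M] [Nonempty M] (p : α → M), T M p → Ψ.Realize p) ∧
      ∀ (A : Type w) [L.Structure A] [Nonempty A] (p : α → A), Ψ.Realize p →
        ∃ (B : Type w) (_ : L.Structure B) (_ : Nonempty B) (q : α → B) (M : Type w)
          (_ : L.Structure M) (t : α → M), T M t ∧
            (Φ.Realize (fun k => (p k, q k)) ↔ Φ.Realize t) := by
  obtain ⟨S, hS, hΦ⟩ := exists_isAutonomous.{u, v, w} (n := 0) Φ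
  have := hS.finite.to_subtype
  -- Being a direct factor of something with the `S`-type of a member of `T` depends only on the
  -- `S`-type of `(A, p)`. There are finitely many such types, so the condition is expressed by a
  -- finite disjunction.
  let Close : ∀ (A : Type w) [L.Structure A], (α → A) → Prop := fun A _ p =>
    ∃ (B : Type w) (_ : L.Structure B) (_ : Nonempty B) (q : α → B) (M : Type w)
      (_ : L.Structure M) (t : α → M), T M t ∧
        SameType S (fun k => (p k, q k)) default t default
  let good : Set S → Prop := fun Y => ∃ (A : Type w) (_ : L.Structure A) (p : α → A), Close A p ∧
    ∀ σ : S, σ.1.Realize p default ↔ σ ∈ Y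
  let Ψ : L.Formula α := Formula.iSup fun Y : {Y // good Y} => typeFormula S Y.1
  have hΨ : ∀ (A : Type w) [L.Structure A] (p : α → A), Ψ.Realize p ↔ Close A p := by
    intro A _ p
    rw [Formula.realize_iSup]
    constructor
    · rintro ⟨⟨Y, A', _, p', ⟨B, _, _, q, M, _, t, ht, hM⟩, hY⟩, hp⟩
      refine ⟨B, inferInstance, inferInstance, q, M, inferInstance, t, ht, SameType.trans ?_ hM⟩
      refine hS.prod _ _ _ _ (fun σ hσ => ?_) fun σ hσ => ?_
      · have h1 := (realize_typeFormula _ _ _ _).1 hp ⟨σ, hσ⟩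
        have h2 := hY ⟨σ, hσ⟩
        rw [Subsingleton.elim (fun k => _ : Fin 0 → A) default,
          Subsingleton.elim (fun k => _ : Fin 0 → A') default]
        exact h1.trans h2.symm
      · rw [Subsingleton.elim (fun k => _ : Fin 0 → B) default,
          Subsingleton.elim (fun k => ((default : Fin 0 → A' × B) k).2) default]
    · intro h
      exact ⟨⟨{σ | σ.1.Realize p default}, A, _, p, h, fun _ => Iff.rfl⟩,
        (realize_typeFormula _ _ _ _).2 fun _ => Iff.rfl⟩
  have hiso : ∀ {M N : Type w} [L.Structure M] [L.Structure N] (g : M ≃[L] N) (p : α → M),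
      SameType S p default (fun k => g (p k)) default := by
    intro M N _ _ g p σ _
    exact (FirstOrder.Language.StrongHomClass.realize_formula g (φ := σ) (v := p)).symm
  refine ⟨Ψ, ?_, ?_, ?_, ?_⟩
  · intro I A _ _ x h
    rw [hΨ]
    choose B _ _ q M _ t ht hM using fun i => (hΨ _ _).1 (h i)
    refine ⟨∀ i, B i, inferInstance, inferInstance, fun k i => q i k, ∀ i, M i, inferInstance,
      fun k i => t i k, hT _ _ ht, ?_⟩
    let g : ((∀ i, A i) × ∀ i, B i) ≃[L] ∀ i, A i × B i := equivOfFunMap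
      { toFun := fun p i => (p.1 i, p.2 i)
        invFun := fun p => (fun i => (p i).1, fun i => (p i).2)
        left_inv := fun _ => rfl
        right_inv := fun _ => rfl } fun _ _ => rfl
    refine (hiso g _).trans (hS.pi _ _ _ _ fun i => ?_)
    rw [Subsingleton.elim (fun k => _ : Fin 0 → A i × B i) default,
      Subsingleton.elim (fun k => _ : Fin 0 → M i) default]
    exact hM i
  · intro A₁ A₂ _ _ _ _ x h
    obtain ⟨B, _, _, q, M, _, t, ht, hM⟩ := (hΨ _ _).1 h
    simp only [hΨ]
    constructor
    · refine ⟨A₂ × B, inferInstance, inferInstance, fun k => ((x k).2, q k), M, inferInstance, t,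
        ht, SameType.trans ?_ hM⟩
      let g : A₁ × (A₂ × B) ≃[L] (A₁ × A₂) × B := equivOfFunMap
        { toFun := fun p => ((p.1, p.2.1), p.2.2)
          invFun := fun p => (p.1.1, p.1.2, p.2)
          left_inv := fun _ => rfl
          right_inv := fun _ => rfl } fun _ _ => rfl
      exact hiso g _
    · refine ⟨A₁ × B, inferInstance, inferInstance, fun k => ((x k).1, q k), M, inferInstance, t,
        ht, SameType.trans ?_ hM⟩
      let g : A₂ × (A₁ × B) ≃[L] (A₁ × A₂) × B := equivOfFunMap
        { toFun := fun p => ((p.2.1, p.1), p.2.2)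
          invFun := fun p => (p.1.2, p.1.1, p.2)
          left_inv := fun _ => rfl
          right_inv := fun _ => rfl } fun _ _ => rfl
      exact hiso g _
  · intro M _ _ p hp
    rw [hΨ]
    -- A member of `T` is a factor of its own product with the one-element algebra.
    let _ : L.Structure PUnit.{w + 1} :=
      { funMap := fun _ _ => PUnit.unit, RelMap := fun r => isEmptyElim r }
    refine ⟨PUnit, inferInstance, inferInstance, fun _ => PUnit.unit, M, inferInstance, p, hp, ?_⟩
    let g : M × PUnit.{w + 1} ≃[L] M := equivOfFunMap
      { toFun := fun p => p.1
        invFun := fun p => (p, PUnit.unit)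
        left_inv := fun _ => rfl
        right_inv := fun _ => rfl } fun _ _ => rfl
    exact hiso g _
  · intro A _ _ p hp
    obtain ⟨B, i₁, i₂, q, M, i₃, t, ht, hM⟩ := (hΨ _ _).1 hp
    exact ⟨B, i₁, i₂, q, M, i₃, t, ht, hM Φ hΦ⟩

end Autonomous

/-! ### Compactness. -/

/-- Compactness for sets of formulas with free variables. -/
theorem exists_finite_unsatisfiable {β : Type u} (Γ : Set (L.Formula β))
    (h : ∀ (M : Type (max u v)) [L.Structure M] (x : β → M), ¬ ∀ φ ∈ Γ, φ.Realize x) :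
    ∃ Γ₀ ⊆ Γ, Γ₀.Finite ∧
      ∀ (M : Type w) [L.Structure M] [Nonempty M] (x : β → M), ¬ ∀ φ ∈ Γ₀, φ.Realize x := by
  by_contra! H
  have hT : FirstOrder.Language.Theory.IsSatisfiable
      (Formula.equivSentence '' Γ : L[[β]].Theory) := by
    rw [FirstOrder.Language.Theory.isSatisfiable_iff_isFinitelySatisfiable]
    intro T₀ hT₀
    obtain ⟨M, _, _, x, hx⟩ := H (Formula.equivSentence.symm '' T₀)
      (by
        rintro _ ⟨σ, hσ, rfl⟩
        obtain ⟨φ, hφ, rfl⟩ := hT₀ hσ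
        rwa [Equiv.symm_apply_apply])
      (T₀.finite_toSet.image _)
    let _ := FirstOrder.Language.constantsOn.structure x
    have : M ⊨ (T₀ : L[[β]].Theory) := ⟨fun σ hσ => by
      have := hx _ ⟨σ, hσ, rfl⟩
      rwa [Formula.realize_equivSentence_symm] at this⟩
    exact FirstOrder.Language.Theory.Model.isSatisfiable M
  obtain ⟨N⟩ := hT
  let _ : L.Structure N := (L.lhomWithConstants β).reduct N
  have : (L.lhomWithConstants β).IsExpansionOn N := inferInstance
  refine h N (fun b => (L.con b : N)) fun φ hφ => ?_
  rw [← Formula.realize_equivSentence]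
  exact Theory.realize_sentence_of_mem (Formula.equivSentence '' Γ) ⟨φ, hφ, rfl⟩

/-! ### Game formulas and strategies. -/

section Play

variable {β : Type u}

open Classical in
/-- Quantification, universal if `univ` and existential otherwise, over the free variable `t`. -/
noncomputable def quantify (univ : Bool) (t : β) (φ : L.Formula β) : L.Formula β :=
  let ψ : L.Formula (β ⊕ Unit) := φ.relabel fun s => if s = t then Sum.inr () else Sum.inl s
  if univ then ψ.iAlls Unit else ψ.iExs Unit

open Classical in
theorem elim_comp_ite {M : Type w} (t : β) (x : β → M) (i : Unit → M) :
    (Sum.elim x i ∘ fun s => if s = t then Sum.inr () else Sum.inl s) =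
      Function.update x t (i ()) := by
  funext s
  by_cases h : s = t
  · subst h
    simp
  · simp [h]

open Classical in
theorem realize_quantify_true (t : β) (φ : L.Formula β) {M : Type w} [L.Structure M] (x : β → M) :
    (quantify true t φ).Realize x ↔ ∀ a, φ.Realize (Function.update x t a) := by
  simp only [quantify, if_true, Formula.realize_iAlls, Formula.realize_relabel]
  constructor
  · intro h a
    have := h fun _ => a
    rwa [elim_comp_ite] at this
  · intro h i
    have := h (i ())
    rwa [← elim_comp_ite t x i] at this

open Classical in
theorem realize_quantify_false (t : β) (φ : L.Formula β) {M : Type w} [L.Structure M]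
    (x : β → M) :
    (quantify false t φ).Realize x ↔ ∃ a, φ.Realize (Function.update x t a) := by
  simp only [quantify, Bool.false_eq_true, if_false, Formula.realize_iExs,
    Formula.realize_relabel, elim_comp_ite]
  exact ⟨fun ⟨i, hi⟩ => ⟨i (), hi⟩, fun ⟨a, ha⟩ => ⟨fun _ => a, ha⟩⟩

/-- The formula quantifying over the variables of a list in turn. -/
noncomputable def play (univ : β → Bool) (ts : List β) (φ : L.Formula β) : L.Formula β :=
  ts.foldr (fun t ψ => quantify (univ t) t ψ) φ

variable {M : Type w} {univ : β → Bool} {child : β → β → Prop}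
  {strat : β → (β → M) → M} {ts : List β} {φ : L.Formula β}

-- Later moves change neither `t` nor the children on which its strategy depends, so the value
-- chosen for `t` still obeys the strategy in the final assignment.
open Classical in
theorem strat_update {t : β}
    (hstrat : ∀ x x', (∀ s, child s t → x s = x' s) → strat t x = strat t x')
    (hirr : ∀ t, ¬ child t t) (ht : ∀ s ∈ ts, s ≠ t ∧ ¬ child s t) {x x' : β → M}
    (hx' : ∀ s ∉ ts, x' s = Function.update x t (strat t x) s) : x' t = strat t x' := by
  rw [hx' t fun h => (ht t h).1 rfl, Function.update_self]
  refine hstrat _ _ fun s hs => ?_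
  rw [hx' s fun h => (ht s h).2 hs, Function.update_of_ne]
  rintro rfl
  exact hirr _ hs

open Classical in
/-- If the existential player wins by following a strategy, then the game formula holds. -/
theorem realize_play [L.Structure M]
    (hstrat : ∀ t ∈ ts, ∀ x x', (∀ s, child s t → x s = x' s) → strat t x = strat t x')
    (hirr : ∀ t, ¬ child t t) (hts : ts.Pairwise fun t s => s ≠ t ∧ ¬ child s t) (x : β → M)
    (h : ∀ x' : β → M, (∀ t ∈ ts, univ t = false → x' t = strat t x') → (∀ s ∉ ts, x' s = x s) →
      φ.Realize x') : (play univ ts φ).Realize x := by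
  induction ts generalizing x with
  | nil => exact h x (by simp) (by simp)
  | cons t ts ih =>
    rw [List.pairwise_cons] at hts
    have step : ∀ a, (univ t = false → a = strat t x) →
        (play univ ts φ).Realize (Function.update x t a) := by
      intro a ha
      refine ih (fun t ht => hstrat t (List.mem_cons_of_mem _ ht)) hts.2 _ fun x' hx' hx'' => h x' ?_ ?_
      · intro s hs hu
        rcases List.mem_cons.1 hs with rfl | hs
        · rw [ha hu] at hx''
          exact strat_update (hstrat _ List.mem_cons_self) hirr hts.1 hx''
        · exact hx' s hs hu
      · intro s hs
        rw [List.mem_cons, not_or] at hs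
        rw [hx'' s hs.2, Function.update_of_ne hs.1]
    change (quantify (univ t) t (play univ ts φ)).Realize x
    rcases hu : univ t with _ | _
    · exact (realize_quantify_false _ _ _).2 ⟨strat t x, step _ fun _ => rfl⟩
    · exact (realize_quantify_true _ _ _).2 fun a => step a (by simp [hu])

open Classical in
/-- If the game formula holds, then the universal player following a strategy reaches an assignment
satisfying the matrix. -/
theorem exists_of_realize_play [L.Structure M]
    (hstrat : ∀ t ∈ ts, ∀ x x', (∀ s, child s t → x s = x' s) → strat t x = strat t x')
    (hirr : ∀ t, ¬ child t t) (hts : ts.Pairwise fun t s => s ≠ t ∧ ¬ child s t) (x : β → M)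
    (h : (play univ ts φ).Realize x) :
    ∃ x' : β → M, (∀ t ∈ ts, univ t = true → x' t = strat t x') ∧ (∀ s ∉ ts, x' s = x s) ∧
      φ.Realize x' := by
  induction ts generalizing x with
  | nil => exact ⟨x, by simp, by simp, h⟩
  | cons t ts ih =>
    rw [List.pairwise_cons] at hts
    change (quantify (univ t) t (play univ ts φ)).Realize x at h
    have step : ∃ a, (univ t = true → a = strat t x) ∧
        (play univ ts φ).Realize (Function.update x t a) := by
      rcases hu : univ t with _ | _ <;> rw [hu] at h
      · obtain ⟨a, ha⟩ := (realize_quantify_false _ _ _).1 h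
        exact ⟨a, by simp, ha⟩
      · exact ⟨_, fun _ => rfl, (realize_quantify_true _ _ _).1 h _⟩
    obtain ⟨a, ha, h'⟩ := step
    obtain ⟨x', hx', hx'', hφ⟩ :=
      ih (fun t ht => hstrat t (List.mem_cons_of_mem _ ht)) hts.2 _ h'
    refine ⟨x', ?_, ?_, hφ⟩
    · intro s hs hu
      rcases List.mem_cons.1 hs with rfl | hs
      · rw [ha hu] at hx''
        exact strat_update (hstrat _ List.mem_cons_self) hirr hts.1 hx''
      · exact hx' s hs hu
    · intro s hs
      rw [List.mem_cons, not_or] at hs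
      rw [hx'' s hs.2, Function.update_of_ne hs.1]

/-- Sorting by rank puts children before parents; since the head of the list is the outermost
quantifier, each move is made knowing the values it depends on. -/
theorem exists_list_pairwise (rank : β → ℕ) (hrank : ∀ s t, child s t → rank s < rank t)
    (C : Set β) (hC : C.Finite) :
    ∃ ts : List β, (∀ t, t ∈ ts ↔ t ∈ C) ∧ ts.Pairwise fun t s => s ≠ t ∧ ¬ child s t := by
  let le : β → β → Bool := fun a b => decide (rank a ≤ rank b)
  have hp := List.mergeSort_perm hC.toFinset.toList le
  refine ⟨hC.toFinset.toList.mergeSort le, fun t => by rw [hp.mem_iff]; simp, ?_⟩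
  have h1 : (hC.toFinset.toList.mergeSort le).Pairwise fun a b => le a b :=
    List.pairwise_mergeSort (fun a b c h k => by simp only [le, decide_eq_true_eq] at *; omega)
      (fun a b => by simp only [le, Bool.or_eq_true, decide_eq_true_eq]; omega) _
  have h2 : (hC.toFinset.toList.mergeSort le).Nodup := hp.nodup_iff.2 (Finset.nodup_toList _)
  refine (h1.and h2).imp fun {a b} h => ⟨fun k => h.2 k.symm, fun k => ?_⟩
  have := hrank _ _ k
  have := h.1
  simp only [le, decide_eq_true_eq] at this
  omega

theorem realize_congr_freeVarFinset [DecidableEq β] (φ : L.Formula β) [L.Structure M]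
    {x x' : β → M} (h : ∀ s ∈ BoundedFormula.freeVarFinset φ, x s = x' s) :
    φ.Realize x ↔ φ.Realize x' := by
  rw [Formula.Realize, Formula.Realize,
    ← BoundedFormula.realize_restrictFreeVar' (φ := φ) subset_rfl (v := x),
    ← BoundedFormula.realize_restrictFreeVar' (φ := φ) subset_rfl (v := x')]
  exact Iff.of_eq (congrArg (fun y => BoundedFormula.Realize _ y _) (funext fun s => h s.1 s.2))

end Play

/-! ### Terms serving as the variables of the game. -/

/-- Terms in the operations of the language and two additional binary operations. -/
inductive DTerm (L : FirstOrder.Language.{u, v}) (α : Type) : Type u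
  | var (a : α) : DTerm L α
  | func {n : ℕ} (f : L.Functions n) (ts : Fin n → DTerm L α) : DTerm L α
  | dec (b : Bool) (s t : DTerm L α) : DTerm L α

namespace DTerm

variable {α : Type}

/-- The immediate subterms of a term. -/
def IsChild (s : DTerm L α) : DTerm L α → Prop
  | var _ => False
  | func _ ts => ∃ i, ts i = s
  | dec _ t t' => t = s ∨ t' = s

/-- The number of operation symbols of a term. -/
def rank : DTerm L α → ℕ
  | var _ => 0
  | func _ ts => (∑ i, rank (ts i)) + 1
  | dec _ s t => rank s + rank t + 1

theorem IsChild.rank_lt {s t : DTerm L α} (h : IsChild s t) : rank s < rank t := by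
  cases t with
  | var a => exact h.elim
  | func f ts =>
    obtain ⟨i, rfl⟩ := h
    have := Finset.single_le_sum (f := fun i => rank (ts i)) (fun _ _ => Nat.zero_le _)
      (Finset.mem_univ i)
    simp only [rank]
    omega
  | dec b t t' =>
    rcases h with rfl | rfl <;> simp only [rank] <;> omega

/-- Sets of terms containing all immediate subterms of their members. -/
def IsClosed (C : Set (DTerm L α)) : Prop := ∀ t ∈ C, ∀ s, IsChild s t → s ∈ C

theorem exists_isClosed (t : DTerm L α) : ∃ C : Set (DTerm L α), C.Finite ∧ IsClosed C ∧ t ∈ C := by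
  induction t with
  | var a =>
    refine ⟨{var a}, Set.finite_singleton _, ?_, rfl⟩
    rintro _ rfl s h
    exact h.elim
  | func f ts ih =>
    choose C hC hC' hC'' using ih
    refine ⟨insert (func f ts) (⋃ i, C i), (Set.finite_iUnion hC).insert _, ?_, Or.inl rfl⟩
    rintro t (rfl | ht) s hs
    · obtain ⟨i, rfl⟩ := hs
      exact Or.inr (Set.mem_iUnion.2 ⟨i, hC'' i⟩)
    · obtain ⟨i, hi⟩ := Set.mem_iUnion.1 ht
      exact Or.inr (Set.mem_iUnion.2 ⟨i, hC' i t hi s hs⟩)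
  | dec b t t' ih ih' =>
    obtain ⟨C, hC, hC', hC''⟩ := ih
    obtain ⟨D, hD, hD', hD''⟩ := ih'
    refine ⟨insert (dec b t t') (C ∪ D), (hC.union hD).insert _, ?_, Or.inl rfl⟩
    rintro r (rfl | hr | hr) s hs
    · rcases hs with rfl | rfl
      · exact Or.inr (Or.inl hC'')
      · exact Or.inr (Or.inr hD'')
    · exact Or.inr (Or.inl (hC' r hr s hs))
    · exact Or.inr (Or.inr (hD' r hr s hs))

theorem exists_isClosed_superset {S : Set (DTerm L α)} (hS : S.Finite) :
    ∃ C : Set (DTerm L α), C.Finite ∧ IsClosed C ∧ S ⊆ C := by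
  choose C hC hC' hC'' using exists_isClosed (L := L) (α := α)
  refine ⟨⋃ t ∈ S, C t, hS.biUnion fun t _ => hC t, ?_, fun t ht => Set.mem_biUnion ht (hC'' t)⟩
  intro t ht s hs
  obtain ⟨r, hr, hr'⟩ := Set.mem_iUnion₂.1 ht
  exact Set.mem_biUnion hr (hC' r t hr' s hs)

/-- Closed terms of the language as terms of the extended language. -/
def ofTerm : L.Term Empty → DTerm L α
  | .var e => e.elim
  | .func f ts => func f fun i => ofTerm (ts i)

theorem apply_ofTerm {M : Type w} [L.Structure M] {x : DTerm L α → M}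
    (h : ∀ {n : ℕ} (f : L.Functions n) (ts : Fin n → DTerm L α),
      x (func f ts) = funMap f fun i => x (ts i)) (t : L.Term Empty) :
    x (ofTerm t) = t.realize (Empty.elim : Empty → M) := by
  induction t with
  | var e => exact e.elim
  | func f ts ih =>
    rw [ofTerm, h, Term.realize_func]
    exact congrArg _ (funext ih)

/-- Whether the value of a term is chosen by the universal player. -/
def isUniv : DTerm L α → Bool
  | dec b _ _ => b
  | _ => false

/-- The value of a term computed from the values of its immediate subterms, when the additional
operations are interpreted as `D`. -/
def step {M : Type w} [L.Structure M] (D : M → M → M) : DTerm L α → (DTerm L α → M) → M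
  | var a, x => x (var a)
  | func f ts, x => funMap f fun i => x (ts i)
  | dec _ s t, x => D (x s) (x t)

/-- Whether a term is not a variable. -/
def IsCompound : DTerm L α → Prop
  | var _ => False
  | _ => True

variable {M : Type w} [L.Structure M] {D : M → M → M}

theorem step_congr (t : DTerm L α) (ht : IsCompound t) {x x' : DTerm L α → M}
    (h : ∀ s, IsChild s t → x s = x' s) : step D t x = step D t x' := by
  cases t with
  | var a => exact ht.elim
  | func f ts => exact congrArg (funMap f) (funext fun i => h _ ⟨i, rfl⟩)
  | dec b s t => exact congrArg₂ D (h _ (Or.inl rfl)) (h _ (Or.inr rfl))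

open Classical in
/-- The assignment agreeing with `x` on `C` and extended to all other terms by the operations. -/
noncomputable def extend (D : M → M → M) (C : Set (DTerm L α)) (x : DTerm L α → M) :
    DTerm L α → M
  | var a => x (var a)
  | func f ts => if func f ts ∈ C then x (func f ts) else funMap f fun i => extend D C x (ts i)
  | dec b s t =>
    if dec b s t ∈ C then x (dec b s t) else D (extend D C x s) (extend D C x t)

theorem extend_of_mem {C : Set (DTerm L α)} {x : DTerm L α → M} {t : DTerm L α} (ht : t ∈ C) :
    extend D C x t = x t := by
  cases t with
  | var a => rfl
  | func f ts => rw [extend, if_pos ht]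
  | dec b s t => rw [extend, if_pos ht]

/-- Only variables in `C` are played. As `C` is closed under subterms, obeying the equations there
suffices for the extension to obey them at every term. -/
theorem extend_eq_step {C : Set (DTerm L α)} (hC : IsClosed C) {x : DTerm L α → M}
    {t : DTerm L α} (h : t ∈ C → IsCompound t → x t = step D t x) :
    extend D C x t = step D t (extend D C x) := by
  by_cases ht : t ∈ C
  · rw [extend_of_mem ht]
    by_cases ht' : IsCompound t
    · rw [h ht ht']
      exact step_congr t ht' fun s hs => (extend_of_mem (hC t ht s hs)).symm
    · cases t with
      | var a => rfl
      | func f ts => exact (ht' trivial).elim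
      | dec b s t => exact (ht' trivial).elim
  · cases t with
    | var a => rfl
    | func f ts => rw [extend, if_neg ht, step]
    | dec b s t => rw [extend, if_neg ht, step]

end DTerm

open DTerm

/-! ### The conditions imposed on the two players. -/

/-- The equation between two variables. -/
def eqVar {β : Type u} (s t : β) : L.Formula β := Term.equal (Term.var s) (Term.var t)

@[simp]
theorem realize_eqVar {β : Type u} {M : Type w} [L.Structure M] (s t : β) (x : β → M) :
    (eqVar (L := L) s t).Realize x ↔ x s = x t := by
  rw [eqVar, Formula.realize_equal]
  rfl

/-- The variable `func f ts` has the correct value. -/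
def eqFunc {α : Type} {n : ℕ} (f : L.Functions n) (ts : Fin n → DTerm L α) :
    L.Formula (DTerm L α) :=
  Term.equal (Term.var (func f ts)) (Term.func f fun i => Term.var (ts i))

@[simp]
theorem realize_eqFunc {α : Type} {n : ℕ} (f : L.Functions n) (ts : Fin n → DTerm L α)
    {M : Type w} [L.Structure M] (x : DTerm L α → M) :
    (eqFunc f ts).Realize x ↔ x (func f ts) = funMap f fun i => x (ts i) := by
  rw [eqFunc, Formula.realize_equal]
  rfl

/-- The conditions expressing that `dec b` is a decomposition operation. -/
inductive DecAxiom {α : Type} (b : Bool) : L.Formula (DTerm L α) → Prop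
  | congr (s s' t t' : DTerm L α) :
    DecAxiom b ((eqVar s s').imp ((eqVar t t').imp (eqVar (dec b s t) (dec b s' t'))))
  | idem (t : DTerm L α) : DecAxiom b (eqVar (dec b t t) t)
  | left (r s t : DTerm L α) : DecAxiom b (eqVar (dec b (dec b r s) t) (dec b r t))
  | right (r s t : DTerm L α) : DecAxiom b (eqVar (dec b r (dec b s t)) (dec b r t))
  -- The premises matter for `b = true`: the existential player may assign wrong values to `func`
  -- terms, and the axiom must still hold for a universal player computing with a genuine
  -- decomposition operation.
  | map {n : ℕ} (f : L.Functions n) (ss ts : Fin n → DTerm L α) :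
    DecAxiom b ((eqFunc f ss).imp ((eqFunc f ts).imp
      (Term.equal (Term.var (dec b (func f ss) (func f ts)))
        (Term.func f fun i => Term.var (dec b (ss i) (ts i))))))

/-- The conditions expressing that the algebra belongs to the variety, that `dec false` is a
decomposition operation with central element `z⃗`, and that `x`, `y` are identified by the
corresponding projection. -/
inductive ExAxiom (E : Set (L.Term ℕ × L.Term ℕ)) {l : ℕ} (zero one : Fin l → L.Term Empty) :
    L.Formula (DTerm L (Fin 2 ⊕ Fin l)) → Prop
  | func {n : ℕ} (f : L.Functions n) (ts : Fin n → DTerm L (Fin 2 ⊕ Fin l)) :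
    ExAxiom E zero one (eqFunc f ts)
  | dec {φ : L.Formula (DTerm L (Fin 2 ⊕ Fin l))} (h : DecAxiom false φ) : ExAxiom E zero one φ
  | central (i : Fin l) : ExAxiom E zero one
    (eqVar (.dec false (ofTerm (zero i)) (ofTerm (one i))) (.var (.inr i)))
  | ident (p : L.Term ℕ × L.Term ℕ) (hp : p ∈ E) (σ : ℕ → DTerm L (Fin 2 ⊕ Fin l)) :
    ExAxiom E zero one (Term.equal (p.1.relabel σ) (p.2.relabel σ))
  | kernel : ExAxiom E zero one
    (eqVar (.dec false (.var (.inl 0)) (.var (.inl 1))) (.var (.inl 1)))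

/-- The conditions expressing that `dec true` is a decomposition operation such that `z⃗` and `0⃗`
are identified by the first projection. -/
inductive AllAxiom {l : ℕ} (zero : Fin l → L.Term Empty) :
    L.Formula (DTerm L (Fin 2 ⊕ Fin l)) → Prop
  | dec {φ : L.Formula (DTerm L (Fin 2 ⊕ Fin l))} (h : DecAxiom true φ) : AllAxiom zero φ
  -- The premise again guards against a wrong value chosen for the constant by the opponent.
  | central (i : Fin l) : AllAxiom zero
    ((Term.equal (Term.var (ofTerm (zero i))) ((zero i).relabel Empty.elim)).imp
      (eqVar (.dec true (.var (.inr i)) (ofTerm (zero i))) (ofTerm (zero i))))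

theorem DecAxiom.realize {α : Type} {b : Bool} {φ : L.Formula (DTerm L α)} (h : DecAxiom b φ)
    {M : Type w} [L.Structure M] {D : M → M → M} (hD : IsDecomp L D) {x : DTerm L α → M}
    (hx : ∀ s t, x (dec b s t) = D (x s) (x t)) : φ.Realize x := by
  cases h with
  | congr s s' t t' =>
    simp only [Formula.realize_imp, realize_eqVar, hx]
    rintro h k
    rw [h, k]
  | idem t => simp only [realize_eqVar, hx, hD.idem]
  | left r s t => simp only [realize_eqVar, hx, hD.left]
  | right r s t => simp only [realize_eqVar, hx, hD.right]
  | map f ss ts =>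
    simp only [Formula.realize_imp, realize_eqFunc, Formula.realize_equal, Term.realize_var,
      Term.realize_func, hx]
    rintro h k
    rw [h, k, hD.map]

theorem ExAxiom.realize {E : Set (L.Term ℕ × L.Term ℕ)} {l : ℕ} {zero one : Fin l → L.Term Empty}
    {φ : L.Formula (DTerm L (Fin 2 ⊕ Fin l))} (h : ExAxiom E zero one φ)
    {M : Type w} [L.Structure M] (hM : InVariety E M) {D : M → M → M} (hD : IsDecomp L D)
    {x : DTerm L (Fin 2 ⊕ Fin l) → M} (hx : ∀ s t, x (.dec false s t) = D (x s) (x t))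
    (hx' : ∀ {n : ℕ} (f : L.Functions n) (ts : Fin n → DTerm L (Fin 2 ⊕ Fin l)),
      x (.func f ts) = funMap f fun i => x (ts i))
    (h1 : ∀ i, D (val zero M i) (val one M i) = x (.var (.inr i)))
    (h2 : D (x (.var (.inl 0))) (x (.var (.inl 1))) = x (.var (.inl 1))) : φ.Realize x := by
  cases h with
  | func f ts => exact (realize_eqFunc _ _ _).2 (hx' f ts)
  | dec h => exact h.realize hD hx
  | central i =>
    rw [realize_eqVar, hx, apply_ofTerm hx', apply_ofTerm hx']
    exact h1 i
  | ident p hp σ =>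
    rw [Formula.realize_equal, Term.realize_relabel, Term.realize_relabel]
    exact hM p hp _
  | kernel => rw [realize_eqVar, hx, h2]

theorem realize_relabel_empty {β : Type*} {M : Type w} [L.Structure M] (t : L.Term Empty)
    (x : β → M) :
    (t.relabel (Empty.elim : Empty → β)).realize x = t.realize (Empty.elim : Empty → M) := by
  rw [Term.realize_relabel]
  congr 1
  exact Subsingleton.elim _ _

theorem AllAxiom.realize {l : ℕ} {zero : Fin l → L.Term Empty}
    {φ : L.Formula (DTerm L (Fin 2 ⊕ Fin l))} (h : AllAxiom zero φ)
    {M : Type w} [L.Structure M] {D : M → M → M} (hD : IsDecomp L D)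
    {x : DTerm L (Fin 2 ⊕ Fin l) → M} (hx : ∀ s t, x (.dec true s t) = D (x s) (x t))
    (h1 : ∀ i, D (x (.var (.inr i))) (val zero M i) = val zero M i) : φ.Realize x := by
  cases h with
  | dec h => exact h.realize hD hx
  | central i =>
    rw [Formula.realize_imp, Formula.realize_equal, realize_relabel_empty, realize_eqVar, hx,
      Term.realize_var]
    intro h
    rw [h]
    exact h1 i

/-- The values of `x` form a subalgebra of `M` in the variety, on which `dec false` and `dec true`
act as decomposition operations. There `le_of_relTuple` applies, and carries the pair `(x, y)` from
the kernel of the first to that of the second. -/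
theorem BooleanFactorCongruences.apply_dec_true [L.IsAlgebraic]
    {E : Set (L.Term ℕ × L.Term ℕ)} {l : ℕ} {zero one : Fin l → L.Term Empty}
    (H : BooleanFactorCongruences.{u, v, max u w} E)
    (h01 : IsZeroOne.{u, v, max u w} E zero one) {M : Type w'} [L.Structure M]
    {x : DTerm L (Fin 2 ⊕ Fin l) → M} (hE : ∀ φ, ExAxiom E zero one φ → φ.Realize x)
    (hA : ∀ φ, AllAxiom zero φ → φ.Realize x) :
    x (.dec true (.var (.inl 0)) (.var (.inl 1))) = x (.var (.inl 1)) := by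
  have hfunc : ∀ {n : ℕ} (f : L.Functions n) (ts : Fin n → DTerm L (Fin 2 ⊕ Fin l)),
      x (.func f ts) = funMap f fun i => x (ts i) := fun f ts =>
    (realize_eqFunc _ _ _).1 (hE _ (.func f ts))
  have hdec : ∀ b φ, DecAxiom b φ → φ.Realize x := by
    rintro (_ | _) φ h
    · exact hE _ (.dec h)
    · exact hA _ (.dec h)
  -- A copy of the range of `x` built from terms, so that it lives in the universe of the hypotheses
  -- wherever `M` lives.
  let Q : Type max u w := ULift.{w} (Quotient (Setoid.ker x))
  let π : DTerm L (Fin 2 ⊕ Fin l) → Q := fun t => ⟨Quotient.mk _ t⟩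
  let ι : Q → M := fun q => Quotient.lift x (fun _ _ h => h) q.down
  have hι : Function.Injective ι := by
    rintro ⟨p⟩ ⟨q⟩ h
    induction p using Quotient.inductionOn with | _ p
    induction q using Quotient.inductionOn with | _ q
    exact congrArg ULift.up (Quotient.sound h)
  have hιπ : ∀ t, ι (π t) = x t := fun _ => rfl
  have hπ : ∀ q, ∃ t, π t = q := by
    rintro ⟨q⟩
    induction q using Quotient.inductionOn with | _ q
    exact ⟨q, rfl⟩
  have heq : ∀ {s t}, (eqVar (L := L) s t).Realize x → π s = π t := fun h =>
    hι ((realize_eqVar _ _ x).1 h)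
  choose sec hsec using id hπ
  let _ : L.Structure Q :=
    { funMap := fun f xs => π (.func f fun i => sec (xs i))
      RelMap := fun r => isEmptyElim r }
  have hιsec : ∀ q, x (sec q) = ι q := fun q => by rw [← hιπ, hsec]
  let g : Q →[L] M := homOfFunMap ι fun f xs => by
    show x (.func f fun i => sec (xs i)) = _
    rw [hfunc]
    simp only [hιsec]
    rfl
  have hQ : InVariety E Q := by
    intro p hp y
    apply hι
    have h := hE _ (.ident p hp fun n => sec (y n))
    rw [Formula.realize_equal, Term.realize_relabel, Term.realize_relabel,
      show (x ∘ fun n => sec (y n)) = g ∘ y from funext fun n => hιsec (y n),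
      FirstOrder.Language.HomClass.realize_term, FirstOrder.Language.HomClass.realize_term] at h
    exact h
  let δ : Bool → Q → Q → Q := fun b p q => π (.dec b (sec p) (sec q))
  have hιδ : ∀ b s t, δ b (π s) (π t) = π (.dec b s t) := by
    intro b s t
    apply hι
    have h := hdec b _ (.congr (sec (π s)) s (sec (π t)) t)
    simp only [Formula.realize_imp, realize_eqVar] at h
    exact h (hιsec _) (hιsec _)
  have hπfunc : ∀ {n : ℕ} (f : L.Functions n) (ts : Fin n → DTerm L (Fin 2 ⊕ Fin l)),
      funMap f (fun i => π (ts i)) = π (.func f ts) := by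
    intro n f ts
    apply hι
    rw [hιπ, hfunc]
    exact g.map_fun f _
  have hδ : ∀ b, IsDecomp L (δ b) := by
    intro b
    refine ⟨fun p => ?_, fun p q r => ?_, fun p q r => ?_, fun {n} f ps qs => ?_⟩
    · obtain ⟨p, rfl⟩ := hπ p
      rw [hιδ]
      exact heq (hdec b _ (.idem _))
    · obtain ⟨p, rfl⟩ := hπ p
      obtain ⟨q, rfl⟩ := hπ q
      obtain ⟨r, rfl⟩ := hπ r
      simp only [hιδ]
      exact heq (hdec b _ (.left _ _ _))
    · obtain ⟨p, rfl⟩ := hπ p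
      obtain ⟨q, rfl⟩ := hπ q
      obtain ⟨r, rfl⟩ := hπ r
      simp only [hιδ]
      exact heq (hdec b _ (.right _ _ _))
    · obtain ⟨ss, rfl⟩ : ∃ ss : Fin n → _, (fun i => π (ss i)) = ps :=
        ⟨fun i => sec (ps i), funext fun i => hsec _⟩
      obtain ⟨ts, rfl⟩ : ∃ ts : Fin n → _, (fun i => π (ts i)) = qs :=
        ⟨fun i => sec (qs i), funext fun i => hsec _⟩
      simp only [hιδ, hπfunc]
      apply hι
      have h := hdec b _ (.map f ss ts)
      simp only [Formula.realize_imp, realize_eqFunc, Formula.realize_equal, Term.realize_var,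
        Term.realize_func] at h
      rw [hιπ, hιπ, hfunc]
      exact h (hfunc f ss) (hfunc f ts)
  have hval : ∀ (c : Fin l → L.Term Empty) i, val c Q i = π (ofTerm (c i)) := by
    intro c i
    apply hι
    rw [hιπ, apply_ofTerm hfunc]
    exact hom_val c g i
  have : Nonempty Q := ⟨π (.var (.inl 0))⟩
  have key := H.le_of_relTuple h01 hQ (Cong.complementary_ofDecomp (hδ false))
    (Cong.complementary_ofDecomp (hδ true)).isFactor (e := fun i => π (.var (.inr i)))
    (fun i => ?_) (fun i => ?_)
  · have h := @key (π (.var (.inl 0))) (π (.var (.inl 1))) (by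
      rw [Cong.ofDecomp_r, hιδ]
      exact heq (hE _ .kernel))
    rw [Cong.ofDecomp_r, hιδ] at h
    exact congrArg ι h
  · refine (Cong.ofDecomp (hδ true)).iseqv.symm ?_
    rw [Cong.ofDecomp_r, hval, hιδ]
    have h := hA _ (.central i)
    rw [Formula.realize_imp, Formula.realize_equal, realize_relabel_empty, realize_eqVar] at h
    exact hι (h (apply_ofTerm hfunc _))
  · rw [Cong.ofDecomp_r, hval]
    have h : δ false (π (ofTerm (zero i))) (π (ofTerm (one i))) = π (.var (.inr i)) := by
      rw [hιδ]
      exact heq (hE _ (.central i))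
    show δ false _ (π (.var (.inr i))) = _
    rw [← h, (hδ false).right, (hδ false).idem]

/-! ### Extraction of the defining formula. -/

/-- The pointed algebras `(M; x, y, z⃗)` in the variety such that `z⃗` is a central element whose
associated first projection identifies `x` and `y`. -/
def IsKernelPair (E : Set (L.Term ℕ × L.Term ℕ)) {l : ℕ} (zero one : Fin l → L.Term Empty)
    (M : Type w) [L.Structure M] (p : Fin 2 ⊕ Fin l → M) : Prop :=
  InVariety E M ∧ ∃ D : M → M → M, IsDecomp L D ∧
    (∀ i, D (val zero M i) (val one M i) = p (.inr i)) ∧ D (p (.inl 0)) (p (.inl 1)) = p (.inl 1)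

theorem IsKernelPair.pi {E : Set (L.Term ℕ × L.Term ℕ)} {l : ℕ} {zero one : Fin l → L.Term Empty}
    {I : Type w} (A : I → Type w) [∀ i, L.Structure (A i)] (p : Fin 2 ⊕ Fin l → ∀ i, A i)
    (h : ∀ i, IsKernelPair E zero one (A i) fun k => p k i) :
    IsKernelPair E zero one (∀ i, A i) p := by
  choose hE D hD h1 h2 using h
  refine ⟨InVariety.pi hE, _, IsDecomp.pi hD, fun k => ?_, funext h2⟩
  rw [val_pi, val_pi]
  exact funext fun i => h1 i k

/-- The parameter denoted by a variable of the game formula. -/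
def paramOf {l : ℕ} : DTerm L (Fin 2 ⊕ Fin l) → Fin 2 ⊕ Fin l
  | .var k => k
  | _ => .inl 0

open Classical in
/-- The game formula extracted from Boolean factor congruences by compactness. -/
theorem BooleanFactorCongruences.exists_formula [L.IsAlgebraic]
    {E : Set (L.Term ℕ × L.Term ℕ)} {l : ℕ} {zero one : Fin l → L.Term Empty}
    (H : BooleanFactorCongruences.{u, v, max u w} E)
    (h01 : IsZeroOne.{u, v, max u w} E zero one) :
    ∃ Φ : L.Formula (Fin 2 ⊕ Fin l),
      (∀ (M : Type (max u w)) [L.Structure M] (p : Fin 2 ⊕ Fin l → M),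
        IsKernelPair E zero one M p → Φ.Realize p) ∧
      ∀ (A B : Type (max u w)) [L.Structure A] [L.Structure B] (p : Fin 2 ⊕ Fin l → A × B),
        (∀ i, (p (.inr i)).1 = val zero A i) → Φ.Realize p →
          (p (.inl 0)).1 = (p (.inl 1)).1 := by
  let goal : DTerm L (Fin 2 ⊕ Fin l) := .dec true (.var (.inl 0)) (.var (.inl 1))
  obtain ⟨Γ, hΓ, hfin, hunsat⟩ := exists_finite_unsatisfiable.{u, v, max u w}
    ({φ | ExAxiom E zero one φ} ∪ {φ | AllAxiom zero φ} ∪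
      {∼(eqVar goal (.var (.inl 1)) : L.Formula (DTerm L (Fin 2 ⊕ Fin l)))}) (by
      intro M _ x hx
      have h := H.apply_dec_true h01 (fun φ hφ => hx φ (Or.inl (Or.inl hφ)))
        fun φ hφ => hx φ (Or.inl (Or.inr hφ))
      have h' := hx _ (Or.inr rfl)
      rw [Formula.realize_not, realize_eqVar] at h'
      exact h' h)
  have := (hfin.inter_of_left {φ | ExAxiom E zero one φ}).to_subtype
  have := (hfin.inter_of_left {φ | AllAxiom zero φ}).to_subtype
  -- The existential player must meet the finitely many `ExAxiom` conditions only if the universal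
  -- player has met the `AllAxiom` ones.
  let body : L.Formula (DTerm L (Fin 2 ⊕ Fin l)) :=
    (Formula.iInf fun φ : ↥(Γ ∩ {φ | AllAxiom zero φ}) => φ.1).imp
      (Formula.iInf fun φ : ↥(Γ ∩ {φ | ExAxiom E zero one φ}) => φ.1)
  have hbody : ∀ {M : Type (max u w)} [L.Structure M] (x : DTerm L (Fin 2 ⊕ Fin l) → M),
      body.Realize x ↔ ((∀ φ ∈ Γ, AllAxiom zero φ → φ.Realize x) →
        ∀ φ ∈ Γ, ExAxiom E zero one φ → φ.Realize x) := by
    intro M _ x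
    simp [body, Formula.realize_imp, Formula.realize_iInf]
  obtain ⟨C, hC, hCc, hCs⟩ := exists_isClosed_superset (L := L) (α := Fin 2 ⊕ Fin l)
    ((hfin.biUnion fun φ _ => (BoundedFormula.freeVarFinset φ).finite_toSet).insert goal)
  have hfree : ∀ φ ∈ Γ, ∀ s ∈ BoundedFormula.freeVarFinset φ, s ∈ C := fun φ hφ s hs =>
    hCs (Or.inr (Set.mem_biUnion hφ hs))
  let child : DTerm L (Fin 2 ⊕ Fin l) → DTerm L (Fin 2 ⊕ Fin l) → Prop := IsChild
  obtain ⟨ts, hts, hpw⟩ := exists_list_pairwise (child := IsChild) rank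
    (fun s t => IsChild.rank_lt) {t ∈ C | IsCompound t} (hC.subset fun _ h => h.1)
  have hstep : ∀ {M : Type (max u w)} [L.Structure M] (D : M → M → M), ∀ t ∈ ts,
      ∀ x x', (∀ s, IsChild s t → x s = x' s) → step D t x = step D t x' := fun D t ht x x' =>
    step_congr t ((hts t).1 ht).2
  have hirr : ∀ t : DTerm L (Fin 2 ⊕ Fin l), ¬ IsChild t t := fun t h => h.rank_lt.ne rfl
  have hvar : ∀ k, (.var k : DTerm L (Fin 2 ⊕ Fin l)) ∉ ts := fun k hk => ((hts _).1 hk).2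
  -- Formulas of `Γ` mention only variables of `C`, so they may be evaluated after the extension,
  -- where the equations of the player following `D` hold for all terms of that player.
  have hext : ∀ {M : Type (max u w)} [L.Structure M] (D : M → M → M)
      (x : DTerm L (Fin 2 ⊕ Fin l) → M), ∀ φ ∈ Γ, (φ.Realize x ↔ φ.Realize (extend D C x)) :=
    fun D x φ hφ => realize_congr_freeVarFinset φ fun s hs =>
      (extend_of_mem (hfree φ hφ s hs)).symm
  refine ⟨(play isUniv ts body).relabel paramOf, ?_, ?_⟩
  · rintro M _ p ⟨hM, D, hD, h1, h2⟩
    rw [Formula.realize_relabel]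
    refine realize_play (hstep D) hirr hpw _ fun x hx hx' => ?_
    rw [hbody]
    intro _ φ hφ hE
    rw [hext D x φ hφ]
    have key : ∀ t, isUniv t = false → extend D C x t = step D t (extend D C x) := fun t ht =>
      extend_eq_step hCc fun h h' => hx t ((hts t).2 ⟨h, h'⟩) ht
    have hv : ∀ k, extend D C x (.var k) = p k := fun k => hx' _ (hvar k)
    refine hE.realize hM hD (fun s t => key _ rfl) (fun f ts => key _ rfl) ?_ ?_
    · simpa only [hv] using h1
    · simpa only [hv] using h2
  · intro A B _ _ p hp h
    rw [Formula.realize_relabel] at h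
    let D : A × B → A × B → A × B := fun q r => (q.1, r.2)
    -- The universal player computes with the product decomposition. All conditions of both players
    -- then hold, so by the choice of `Γ` the negated goal must fail.
    obtain ⟨x, hx, hx', hb⟩ := exists_of_realize_play (hstep D) hirr hpw _ h
    have hv : ∀ k, x (.var k) = p k := fun k => hx' _ (hvar k)
    rw [hbody] at hb
    have hall : ∀ φ ∈ Γ, AllAxiom zero φ → φ.Realize x := by
      intro φ hφ hA
      rw [hext D x φ hφ]
      refine hA.realize (isDecomp_prod A B) (fun s t => ?_) fun i => ?_
      · exact extend_eq_step hCc fun h h' => hx _ ((hts _).2 ⟨h, h'⟩) rfl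
      · rw [show extend D C x (.var (.inr i)) = p (.inr i) from hv _, hp, val_prod]
    have hex := hb hall
    have hgoal : x goal = x (.var (.inl 1)) := by
      by_contra hne
      have : Nonempty (A × B) := ⟨p (.inl 0)⟩
      refine hunsat (A × B) x fun φ hφ => ?_
      rcases hΓ hφ with (h | h) | h
      · exact hex φ hφ h
      · exact hall φ hφ h
      · rw [h, Formula.realize_not, realize_eqVar]
        exact hne
    have hg : x goal = D (x (.var (.inl 0))) (x (.var (.inl 1))) :=
      hx goal ((hts _).2 ⟨hCs (Or.inl rfl), trivial⟩) rfl
    rw [hg, hv, hv] at hgoal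
    exact (Prod.ext_iff.1 hgoal).1

/-! ### Central elements and complementary congruences. -/

section Central

variable {E : Set (L.Term ℕ × L.Term ℕ)} {l : ℕ} {zero one : Fin l → L.Term Empty}
  {A : Type w} [L.Structure A]

theorem equiv_val_prod {B C : Type w} [L.Structure B] [L.Structure C] (h : A ≃[L] B × C)
    (t : Fin l → L.Term Empty) (i : Fin l) : h (val t A i) = (val t B i, val t C i) :=
  (hom_val t h.toHom i).trans (val_prod t i)

theorem Cong.Complementary.isCentral {θ φ : Cong L A} (h : Complementary θ φ) {e : Fin l → A}
    (h1 : θ.RelTuple (val zero A) e) (h2 : φ.RelTuple e (val one A)) : IsCentral zero one e := by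
  obtain ⟨B, C, _, _, g, hθ, hφ⟩ := h
  refine ⟨B, C, _, _, g, fun i => Prod.ext ?_ ?_⟩
  · rw [← (hθ _ _).1 (h1 i), equiv_val_prod]
  · rw [(hφ _ _).1 (h2 i), equiv_val_prod]

theorem Cong.Complementary.isComplementaryCentral {θ φ : Cong L A} (h : Complementary θ φ)
    {e f : Fin l → A} (h1 : θ.RelTuple (val zero A) e) (h2 : φ.RelTuple e (val one A))
    (h3 : θ.RelTuple (val one A) f) (h4 : φ.RelTuple f (val zero A)) :
    IsComplementaryCentral zero one e f := by
  obtain ⟨B, C, _, _, g, hθ, hφ⟩ := h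
  refine ⟨B, C, _, _, g, fun i => Prod.ext ?_ ?_, fun i => Prod.ext ?_ ?_⟩
  · rw [← (hθ _ _).1 (h1 i), equiv_val_prod]
  · rw [(hφ _ _).1 (h2 i), equiv_val_prod]
  · rw [← (hθ _ _).1 (h3 i), equiv_val_prod]
  · rw [(hφ _ _).1 (h4 i), equiv_val_prod]

theorem exists_complementary_kernels {B C : Type w} [L.Structure B] [L.Structure C]
    (g : A ≃[L] B × C) : ∃ θ φ : Cong L A, Complementary θ φ ∧
      (∀ x y, θ.r x y ↔ (g x).1 = (g y).1) ∧ ∀ x y, φ.r x y ↔ (g x).2 = (g y).2 :=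
  ⟨(⊥ : Cong L B).comap ((fstHom B C).comp g.toHom), (⊥ : Cong L C).comap ((sndHom B C).comp g.toHom),
    ⟨B, C, _, _, g, fun _ _ => Iff.rfl, fun _ _ => Iff.rfl⟩, fun _ _ => Iff.rfl, fun _ _ => Iff.rfl⟩

theorem IsCentral.exists_complementary {e : Fin l → A} (h : IsCentral zero one e) :
    ∃ θ φ : Cong L A, Complementary θ φ ∧ θ.RelTuple (val zero A) e ∧
      φ.RelTuple e (val one A) := by
  obtain ⟨B, C, _, _, g, hg⟩ := h
  obtain ⟨θ, φ, hc, hθ, hφ⟩ := exists_complementary_kernels g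
  refine ⟨θ, φ, hc, fun i => ?_, fun i => ?_⟩
  · rw [hθ, hg, equiv_val_prod]
  · rw [hφ, hg, equiv_val_prod]

theorem IsComplementaryCentral.exists_complementary {e f : Fin l → A}
    (h : IsComplementaryCentral zero one e f) :
    ∃ θ φ : Cong L A, Complementary θ φ ∧ θ.RelTuple (val zero A) e ∧
      φ.RelTuple e (val one A) ∧ θ.RelTuple (val one A) f ∧ φ.RelTuple f (val zero A) := by
  obtain ⟨B, C, _, _, g, hg, hg'⟩ := h
  obtain ⟨θ, φ, hc, hθ, hφ⟩ := exists_complementary_kernels g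
  refine ⟨θ, φ, hc, fun i => ?_, fun i => ?_, fun i => ?_, fun i => ?_⟩
  · rw [hθ, hg, equiv_val_prod]
  · rw [hφ, hg, equiv_val_prod]
  · rw [hθ, hg', equiv_val_prod]
  · rw [hφ, hg', equiv_val_prod]

theorem comp_sumElim_vec {M N α : Type*} (g : M → N) (x y : M) (e : α → M) :
    (g ∘ Sum.elim ![x, y] e) = Sum.elim ![g x, g y] fun i => g (e i) := by
  rw [Sum.comp_elim]
  congr 1
  funext i
  fin_cases i <;> rfl

variable [Nonempty A]

theorem InVariety.factors {B C : Type w} [L.Structure B] [L.Structure C] (hA : InVariety E A)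
    (g : A ≃[L] B × C) : Nonempty B ∧ Nonempty C ∧ InVariety E B ∧ InVariety E C := by
  have a := g (Classical.arbitrary A)
  refine ⟨⟨a.1⟩, ⟨a.2⟩, hA.of_surjective ((fstHom B C).comp g.toHom) fun b => ?_,
    hA.of_surjective ((sndHom B C).comp g.toHom) fun c => ?_⟩
  · obtain ⟨x, hx⟩ := g.surjective (b, a.2)
    exact ⟨x, congrArg Prod.fst hx⟩
  · obtain ⟨x, hx⟩ := g.surjective (a.1, c)
    exact ⟨x, congrArg Prod.snd hx⟩

theorem DefinesKernel.realize_iff {Φ : L.Formula (Fin 2 ⊕ Fin l)}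
    (hΦ : DefinesKernel.{u, v, w} E zero one Φ) (hA : InVariety E A) {θ φ : Cong L A}
    (h : Complementary θ φ) {e : Fin l → A} (h1 : θ.RelTuple (val zero A) e)
    (h2 : φ.RelTuple e (val one A)) (x y : A) :
    Φ.Realize (Sum.elim ![x, y] e) ↔ θ.r x y := by
  obtain ⟨B, C, _, _, g, hθ, hφ⟩ := h
  obtain ⟨_, _, hB, hC⟩ := hA.factors g
  have he : ∀ i, g (e i) = (val zero B i, val one C i) := by
    refine fun i => Prod.ext ?_ ?_
    · rw [← (hθ _ _).1 (h1 i), equiv_val_prod]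
    · rw [(hφ _ _).1 (h2 i), equiv_val_prod]
  rw [hθ, ← hΦ B C hB hC (g x).1 (g y).1 (g x).2 (g y).2,
    ← FirstOrder.Language.StrongHomClass.realize_formula g, comp_sumElim_vec]
  simp only [he]

theorem DefinesKernelTwo.realize_iff {Φ : L.Formula (Fin 2 ⊕ (Fin l ⊕ Fin l))}
    (hΦ : DefinesKernelTwo.{u, v, w} E zero one Φ) (hA : InVariety E A) {θ φ : Cong L A}
    (h : Complementary θ φ) {e f : Fin l → A} (h1 : θ.RelTuple (val zero A) e)
    (h2 : φ.RelTuple e (val one A)) (h3 : θ.RelTuple (val one A) f)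
    (h4 : φ.RelTuple f (val zero A)) (x y : A) :
    Φ.Realize (Sum.elim ![x, y] (Sum.elim e f)) ↔ θ.r x y := by
  obtain ⟨B, C, _, _, g, hθ, hφ⟩ := h
  obtain ⟨_, _, hB, hC⟩ := hA.factors g
  have he : ∀ i, g (e i) = (val zero B i, val one C i) := by
    refine fun i => Prod.ext ?_ ?_
    · rw [← (hθ _ _).1 (h1 i), equiv_val_prod]
    · rw [(hφ _ _).1 (h2 i), equiv_val_prod]
  have hf : ∀ i, g (f i) = (val one B i, val zero C i) := by
    refine fun i => Prod.ext ?_ ?_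
    · rw [← (hθ _ _).1 (h3 i), equiv_val_prod]
    · rw [(hφ _ _).1 (h4 i), equiv_val_prod]
  rw [hθ, ← hΦ B C hB hC (g x).1 (g y).1 (g x).2 (g y).2,
    ← FirstOrder.Language.StrongHomClass.realize_formula g, comp_sumElim_vec]
  have : (fun i => g (Sum.elim e f i)) = Sum.elim (fun i => (val zero B i, val one C i))
      fun i => (val one B i, val zero C i) := by
    funext i
    rcases i with i | i
    · exact he i
    · exact hf i
  rw [this]

end Central

/-! ### The implications between the properties. -/

section Equivalences

variable {E : Set (L.Term ℕ × L.Term ℕ)} {l : ℕ}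
  {zero one : Fin l → L.Term Empty}

theorem WeakDeterminingProperty.determined (H : WeakDeterminingProperty.{u, v, w} E zero one) :
    DeterminedByCentralPairs.{u, v, w} E zero one := by
  intro A _ _ hA θ θ' φ φ' hθ hφ e f a1 a2 a3 a4 b1 b2 b3 b4
  obtain ⟨F, hF, hinj, -⟩ := H A hA
  have := hinj (Subtype.ext (((hF ⟨(θ, θ'), hθ⟩ e f).1 ⟨a1, a2, a3, a4⟩).symm.trans
    ((hF ⟨(φ, φ'), hφ⟩ e f).1 ⟨b1, b2, b3, b4⟩)))
  exact congrArg (fun p => p.1.1) this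

theorem DeterminingProperty.determined (H : DeterminingProperty.{u, v, w} E zero one) :
    DeterminedByCentralPairs.{u, v, w} E zero one := by
  intro A _ _ hA θ θ' φ φ' hθ hφ e f a1 a2 a3 a4 b1 b2 b3 b4
  obtain ⟨F, hF, hinj, -⟩ := H A hA
  have := hinj (Subtype.ext (((hF ⟨(θ, θ'), hθ⟩ e).1 ⟨a1, a2⟩).symm.trans
    ((hF ⟨(φ, φ'), hφ⟩ e).1 ⟨b1, b2⟩)))
  exact congrArg (fun p => p.1.1) this

theorem DefinableFactorCongruences.determined
    (H : DefinableFactorCongruences.{u, v, w} E zero one) :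
    DeterminedByCentralPairs.{u, v, w} E zero one := by
  obtain ⟨Φ, hΦ⟩ := H
  intro A _ _ hA θ θ' φ φ' hθ hφ e f a1 a2 a3 a4 b1 b2 b3 b4
  exact Cong.ext_r fun x y =>
    (hΦ.realize_iff hA hθ a1 a2 x y).symm.trans (hΦ.realize_iff hA hφ b1 b2 x y)

theorem DefinableFactorCongruencesTwo.determined
    (H : DefinableFactorCongruencesTwo.{u, v, w} E zero one) :
    DeterminedByCentralPairs.{u, v, w} E zero one := by
  obtain ⟨Φ, hΦ⟩ := H
  intro A _ _ hA θ θ' φ φ' hθ hφ e f a1 a2 a3 a4 b1 b2 b3 b4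
  exact Cong.ext_r fun x y => (hΦ.realize_iff hA hθ a1 a2 a3 a4 x y).symm.trans
    (hΦ.realize_iff hA hφ b1 b2 b3 b4 x y)

theorem DefinesKernel.toTwo {Φ : L.Formula (Fin 2 ⊕ Fin l)}
    (hΦ : DefinesKernel.{u, v, w} E zero one Φ) :
    DefinesKernelTwo.{u, v, w} E zero one (Φ.relabel (Sum.map id Sum.inl)) := by
  intro A B _ _ _ _ hA hB a c b d
  rw [Formula.realize_relabel, Sum.elim_comp_map]
  exact hΦ A B hA hB a c b d

variable [L.IsAlgebraic]

theorem DeterminedByCentralPairs.booleanFactorCongruences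
    (H : DeterminedByCentralPairs.{u, v, w} E zero one) : BooleanFactorCongruences.{u, v, w} E :=
  fun _ _ _ hA => ((factorsDecompose_of_determined H).isBooleanSublattice hA).1

/-- The hypotheses are symmetric in the two pairs, giving both inclusions for the first components.
The second components are handled by exchanging the roles of `0` and `1`. -/
theorem BooleanFactorCongruences.complementary_unique
    (H : BooleanFactorCongruences.{u, v, w} E) (h01 : IsZeroOne.{u, v, w} E zero one)
    {A : Type w} [L.Structure A] [Nonempty A] (hA : InVariety E A) {θ θ' φ φ' : Cong L A}
    (hθ : Complementary θ θ') (hφ : Complementary φ φ') {e : Fin l → A}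
    (a1 : θ.RelTuple (val zero A) e) (a2 : θ'.RelTuple e (val one A))
    (b1 : φ.RelTuple (val zero A) e) (b2 : φ'.RelTuple e (val one A)) : θ = φ ∧ θ' = φ' := by
  have h := le_antisymm (H.le_of_relTuple h01 hA hθ hφ.isFactor b1 a2)
    (H.le_of_relTuple h01 hA hφ hθ.isFactor a1 b2)
  have h01' : IsZeroOne.{u, v, w} E one zero := fun B _ _ hB h x y => h01 B hB h.symm x y
  have sym : ∀ (ψ : Cong L A) {a b : Fin l → A}, ψ.RelTuple a b → ψ.RelTuple b a :=
    fun ψ a b h i => ψ.iseqv.symm (h i)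
  exact ⟨h, le_antisymm
    (H.le_of_relTuple h01' hA hθ.symm hφ.symm.isFactor (sym _ b2) (sym _ a1))
    (H.le_of_relTuple h01' hA hφ.symm hθ.symm.isFactor (sym _ a2) (sym _ b1))⟩

theorem BooleanFactorCongruences.complement_unique (H : BooleanFactorCongruences.{u, v, w} E)
    {A : Type w} [L.Structure A] [Nonempty A] (hA : InVariety E A) {θ φ φ' : Cong L A}
    (h : Complementary θ φ) (h' : Complementary θ φ') : φ = φ' := by
  have key : ∀ {φ φ' : Cong L A}, Complementary θ φ → Complementary θ φ' → φ ≤ φ' := by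
    intro φ φ' h h'
    have := (H A hA).2 φ h.symm.isFactor θ h.isFactor φ' h'.symm.isFactor
    rw [h'.isCompl.sup_eq_top, inf_top_eq, h.symm.isCompl.inf_eq_bot, bot_sup_eq] at this
    exact this.le.trans inf_le_right
  exact le_antisymm (key h h') (key h' h)

theorem BooleanFactorCongruences.determiningProperty (H : BooleanFactorCongruences.{u, v, w} E)
    (h01 : IsZeroOne.{u, v, w} E zero one) : DeterminingProperty.{u, v, w} E zero one := by
  intro A _ _ hA
  choose e he he' using fun p : {p : Cong L A × Cong L A // Complementary p.1 p.2} =>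
    p.2.exists_tuple (val zero A) (val one A)
  refine ⟨fun p => ⟨e p, p.2.isCentral (he p) (he' p)⟩, fun p e' => ⟨fun h => ?_, ?_⟩, ?_, ?_⟩
  · exact p.2.tuple_eq h.1 h.2 (he p) (he' p)
  · rintro rfl
    exact ⟨he p, he' p⟩
  · intro p q h
    have hpq : e p = e q := congrArg Subtype.val h
    have := H.complementary_unique h01 hA p.2 q.2 (he p) (he' p) (hpq ▸ he q) (hpq ▸ he' q)
    exact Subtype.ext (Prod.ext this.1 this.2)
  · rintro ⟨e', h⟩
    obtain ⟨θ, φ, hc, h1, h2⟩ := h.exists_complementary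
    exact ⟨⟨(θ, φ), hc⟩, Subtype.ext (hc.tuple_eq (he ⟨(θ, φ), hc⟩) (he' _) h1 h2)⟩

theorem BooleanFactorCongruences.weakDeterminingProperty
    (H : BooleanFactorCongruences.{u, v, w} E)
    (h01 : IsZeroOne.{u, v, w} E zero one) : WeakDeterminingProperty.{u, v, w} E zero one := by
  intro A _ _ hA
  choose e he he' using fun p : {p : Cong L A × Cong L A // Complementary p.1 p.2} =>
    p.2.exists_tuple (val zero A) (val one A)
  choose f hf hf' using fun p : {p : Cong L A × Cong L A // Complementary p.1 p.2} =>
    p.2.exists_tuple (val one A) (val zero A)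
  refine ⟨fun p => ⟨(e p, f p), p.2.isComplementaryCentral (he p) (he' p) (hf p) (hf' p)⟩,
    fun p e' f' => ⟨fun h => ?_, fun h => ?_⟩, ?_, ?_⟩
  · exact Prod.ext (p.2.tuple_eq h.1 h.2.1 (he p) (he' p))
      (p.2.tuple_eq h.2.2.1 h.2.2.2 (hf p) (hf' p))
  · obtain ⟨rfl, rfl⟩ := Prod.ext_iff.1 h
    exact ⟨he p, he' p, hf p, hf' p⟩
  · intro p q h
    have hpq : e p = e q := congrArg (fun r => r.1.1) h
    have := H.complementary_unique h01 hA p.2 q.2 (he p) (he' p) (hpq ▸ he q) (hpq ▸ he' q)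
    exact Subtype.ext (Prod.ext this.1 this.2)
  · rintro ⟨⟨e', f'⟩, h⟩
    obtain ⟨θ, φ, hc, h1, h2, h3, h4⟩ := h.exists_complementary
    exact ⟨⟨(θ, φ), hc⟩, Subtype.ext (Prod.ext (hc.tuple_eq (he ⟨(θ, φ), hc⟩) (he' _) h1 h2)
      (hc.tuple_eq (hf ⟨(θ, φ), hc⟩) (hf' _) h3 h4))⟩

theorem BooleanFactorCongruences.exists_definesKernel
    (H : BooleanFactorCongruences.{u, v, max u w} E)
    (h01 : IsZeroOne.{u, v, max u w} E zero one) :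
    ∃ Ψ : L.Formula (Fin 2 ⊕ Fin l), DefinesKernel.{u, v, max u w} E zero one Ψ ∧
      PreservedByProducts.{u, v, max u w} Ψ ∧ PreservedByFactors.{u, v, max u w} Ψ := by
  obtain ⟨Φ, hΦ1, hΦ2⟩ := BooleanFactorCongruences.exists_formula.{u, v, w} H h01
  obtain ⟨Ψ, hprod, hfac, hΨ1, hΨ2⟩ := exists_preserved_formula.{u, v, max u w}
    (fun M _ p => IsKernelPair E zero one M p) (fun A _ p h => IsKernelPair.pi A p h) Φ
  refine ⟨Ψ, ?_, hprod, hfac⟩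
  intro A B _ _ _ _ hA hB a c b d
  constructor
  · intro h
    -- Preservation by factors moves to `A`, where `z` becomes `0`. The cofactor `B'` is an
    -- arbitrary algebra, possibly outside the variety, which the game formula tolerates.
    obtain ⟨B', _, _, q, M, _, t, ht, hM⟩ := hΨ2 _ _ (hfac A B _ h).1
    exact hΦ2 A B' _ (fun i => rfl) (hM.2 (hΦ1 M t ht))
  · rintro rfl
    refine hΨ1 _ _ ⟨hA.prod hB, _, isDecomp_prod A B, fun i => ?_, rfl⟩
    rw [val_prod, val_prod]
    rfl

theorem DefinesKernel.centralBijection {Φ : L.Formula (Fin 2 ⊕ Fin l)}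
    (hΦ : DefinesKernel.{u, v, w} E zero one Φ) {A : Type w} [L.Structure A] [Nonempty A]
    (hA : InVariety E A) : CentralBijection zero one Φ A := by
  have H := (DefinableFactorCongruences.determined ⟨Φ, hΦ⟩).booleanFactorCongruences
  choose θ φ hc h1 h2 using fun e : {e : Fin l → A // IsCentral zero one e} =>
    e.2.exists_complementary
  refine ⟨fun e => ⟨θ e, (hc e).isFactor⟩, fun e x y =>
    (hΦ.realize_iff hA (hc e) (h1 e) (h2 e) x y).symm, ?_, ?_⟩
  · intro e e' h
    have hθ : θ e = θ e' := congrArg Subtype.val h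
    -- Distributivity makes complements unique, so the first kernel determines the second, and
    -- together they determine the central element.
    have hφ : φ e = φ e' := H.complement_unique hA (hc e) (hθ ▸ hc e')
    exact Subtype.ext ((hc e).tuple_eq (h1 e) (h2 e) (hθ ▸ h1 e') (hφ ▸ h2 e'))
  · rintro ⟨ψ, ψ', hψ⟩
    obtain ⟨e, he, he'⟩ := hψ.exists_tuple (val zero A) (val one A)
    have hcent := hψ.isCentral he he'
    refine ⟨⟨e, hcent⟩, Subtype.ext (Cong.ext_r fun x y => ?_)⟩
    exact (hΦ.realize_iff hA (hc ⟨e, hcent⟩) (h1 _) (h2 _) x y).symm.trans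
      (hΦ.realize_iff hA hψ he he' x y)

end Equivalences

end FactorCongruences

theorem theorem1 (L : FirstOrder.Language.{u, v}) [L.IsAlgebraic] (E : Set (L.Term ℕ × L.Term ℕ)) (l : ℕ)
    (zero one : Fin l → L.Term Empty)
    (h01 : FactorCongruences.IsZeroOne.{u, v, max u w} E zero one) :
    [FactorCongruences.WeakDeterminingProperty.{u, v, max u w} E zero one,
      FactorCongruences.DeterminingProperty.{u, v, max u w} E zero one,
      FactorCongruences.DefinableFactorCongruences.{u, v, max u w} E zero one,
      FactorCongruences.DefinableFactorCongruencesTwo.{u, v, max u w} E zero one,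
      FactorCongruences.BooleanFactorCongruences.{u, v, max u w} E].TFAE ∧
    (FactorCongruences.DefinableFactorCongruences.{u, v, max u w} E zero one →
      (∃ Φ : L.Formula (Fin 2 ⊕ Fin l),
        FactorCongruences.DefinesKernel.{u, v, max u w} E zero one Φ ∧
        FactorCongruences.PreservedByProducts.{u, v, max u w} Φ ∧
        FactorCongruences.PreservedByFactors.{u, v, max u w} Φ) ∧
      ∀ (A : Type (max u w)) [L.Structure A] [Nonempty A], FactorCongruences.InVariety E A →
        FactorCongruences.IsBooleanSublattice
          {θ : FactorCongruences.Cong L A | θ.IsFactor} ∧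
        ∀ Φ : L.Formula (Fin 2 ⊕ Fin l),
          FactorCongruences.DefinesKernel.{u, v, max u w} E zero one Φ →
          FactorCongruences.CentralBijection zero one Φ A) := by
  refine ⟨?_, fun H => ⟨?_, fun A _ _ hA => ⟨?_, fun Φ hΦ => hΦ.centralBijection hA⟩⟩⟩
  · tfae_have 1 → 5 := fun H => H.determined.booleanFactorCongruences
    tfae_have 2 → 5 := fun H => H.determined.booleanFactorCongruences
    tfae_have 4 → 5 := fun H => H.determined.booleanFactorCongruences
    tfae_have 5 → 1 := fun H => H.weakDeterminingProperty h01
    tfae_have 5 → 2 := fun H => H.determiningProperty h01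
    tfae_have 5 → 3 := fun H =>
      (FactorCongruences.BooleanFactorCongruences.exists_definesKernel.{u, v, w} H h01).imp
        fun _ h => h.1
    tfae_have 3 → 4 := fun ⟨_, hΦ⟩ => ⟨_, hΦ.toTwo⟩
    tfae_finish
  · exact FactorCongruences.BooleanFactorCongruences.exists_definesKernel.{u, v, w}
      H.determined.booleanFactorCongruences h01
  · exact (FactorCongruences.factorsDecompose_of_determined H.determined).isBooleanSublattice hA
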